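/- Let $d\in\{2,3\}$, let $D\subset\mathbb R^d$ be a bounded open set with $0\in D$, and let $B\subset\mathbb R^d$ be a bounded open set with $C^\infty$ boundary, lying locally on one side of it (for instance a smooth deformation of a ball centered at the origin), with outward unit normal $\nu$ on $\partial B$. Let $A,A_1\in\mathbb R^{d\times d}$ be constant symmetric positive definite matrices, $\widetilde A=A_1\chi_B+A(1-\chi_B)$, and $A_{min}=\inf_{\xi\in\mathbb C^d,\,|\xi|=1}\overline\xi\cdot A\xi>0$. Let $w:D\to\mathbb C$ be a smooth function. For small $\varepsilon>0$ put $\widetilde D=\frac1\varepsilon D$ and let $w^{(1)}_\varepsilon\in H^1_0(\widetilde D)$ be the solution of $$\int_{\widetilde D}\widetilde A\nabla w^{(1)}_\varepsilon\cdot\nabla\overline\varphi+A_{min}\,w^{(1)}_\varepsilon\overline\varphi\,dy=\int_{\partial B}\big[(A_1-A)\nabla w(0)\cdot\nu\big]\overline\varphi\,ds\qquad\text{for all }\varphi\in C_c^\infty(\widetilde D;\mathbb C)$$ (equivalently, for all $\varphi\in H^1_0(\widetilde D)$), and let $w^{(1)}\in H^1(\mathbb R^d)$ be the solution of $$\int_{\mathbb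 R^d}\widetilde A\nabla w^{(1)}\cdot\nabla\overline\varphi+A_{min}\,w^{(1)}\overline\varphi\,dy=\int_{\partial B}\big[(A_1-A)\nabla w(0)\cdot\nu\big]\overline\varphi\,ds\qquad\text{for all }\varphi\in C_c^\infty(\mathbb R^d;\mathbb C)$$ (equivalently, for all $\varphi\in H^1(\mathbb R^d)$). Then, for all sufficiently small $\varepsilon>0$, the function $x\mapsto w^{(1)}_\varepsilon(x/\varepsilon)-w^{(1)}(x/\varepsilon)$ belongs to $H^1(D)$, and as $\varepsilon\to0^+$ $$\|w^{(1)}_\varepsilon(x/\varepsilon)-w^{(1)}(x/\varepsilon)\|_{H^1(D)}=o(\varepsilon^{d/2+2})\quad\text{if }d=2,$$ $$\|w^{(1)}_\varepsilon(x/\varepsilon)-w^{(1)}(x/\varepsilon)\|_{H^1(D)}=o(\varepsilon^{d/2+5/2})\quad\text{if }d=3.$$ -/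

import Mathlib

open MeasureTheory Filter Topology Asymptotics
open scoped ContDiff Pointwise ComplexConjugate

noncomputable section

/-- Euclidean space of dimension `d`, with the Euclidean norm. -/
abbrev Eu (d : ℕ) : Type := EuclideanSpace ℝ (Fin d)

/-- The classical partial derivative of `f` at `x` in the `i`-th coordinate direction. -/
def partialD {d : ℕ} {F : Type*} [NormedAddCommGroup F] [NormedSpace ℝ F]
    (i : Fin d) (f : Eu d → F) (x : Eu d) : F :=
  fderiv ℝ f x (EuclideanSpace.single i 1)

/-- Smooth functions with compact support contained in `Ω`. -/
def IsTest {d : ℕ} {F : Type*} [NormedAddCommGroup F] [NormedSpace ℝ F]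
    (Ω : Set (Eu d)) (φ : Eu d → F) : Prop :=
  ContDiff ℝ ∞ φ ∧ HasCompactSupport φ ∧ tsupport φ ⊆ Ω

/-- `g` is a square integrable weak `i`-th partial derivative of `u` on the open set `Ω`. -/
def HasWeakPartial {d : ℕ} (Ω : Set (Eu d)) (i : Fin d) (u g : Eu d → ℂ) : Prop :=
  MemLp g 2 (volume.restrict Ω) ∧
    ∀ φ : Eu d → ℝ, IsTest Ω φ →
      ∫ x in Ω, partialD i φ x • u x = -∫ x in Ω, φ x • g x

/-- `u ∈ H¹(Ω)`: `u` and its first weak partial derivatives are square integrable on `Ω`. -/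
def MemH1 {d : ℕ} (Ω : Set (Eu d)) (u : Eu d → ℂ) : Prop :=
  MemLp u 2 (volume.restrict Ω) ∧ ∀ i : Fin d, ∃ g, HasWeakPartial Ω i u g

open Classical in
/-- The `i`-th weak partial derivative of `u` on `Ω` (unique up to null sets; `0` if there is
none). -/
def weakPartial {d : ℕ} (Ω : Set (Eu d)) (i : Fin d) (u : Eu d → ℂ) : Eu d → ℂ :=
  if h : ∃ g, HasWeakPartial Ω i u g then h.choose else 0

/-- The norm of `H¹(Ω)`, to be used for `u` with `MemH1 Ω u`. -/
def h1Norm {d : ℕ} (Ω : Set (Eu d)) (u : Eu d → ℂ) : ℝ :=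
  Real.sqrt ((∫ x in Ω, ‖u x‖ ^ 2) + ∑ i : Fin d, ∫ x in Ω, ‖weakPartial Ω i u x‖ ^ 2)

/-- `u ∈ H¹₀(Ω)`: the closure in `H¹(Ω)` of the smooth functions with compact support in `Ω`. -/
def MemH10 {d : ℕ} (Ω : Set (Eu d)) (u : Eu d → ℂ) : Prop :=
  MemH1 Ω u ∧ ∃ φ : ℕ → Eu d → ℂ, (∀ n, IsTest Ω (φ n)) ∧
    Tendsto (fun n => h1Norm Ω (fun x => u x - φ n x)) atTop (𝓝 0)

/-- `ρ` is a smooth defining function of `B` near the boundary point `y`. -/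
def IsDefiningFunction {d : ℕ} (B : Set (Eu d)) (y : Eu d) (ρ : Eu d → ℝ) : Prop :=
  ContDiff ℝ ∞ ρ ∧ gradient ρ y ≠ 0 ∧ ∀ᶠ x in 𝓝 y, (x ∈ B ↔ ρ x < 0)

/-- The boundary of `B` is smooth, with `B` locally on one side of it. -/
def HasSmoothBoundary {d : ℕ} (B : Set (Eu d)) : Prop :=
  ∀ y ∈ frontier B, ∃ ρ, IsDefiningFunction B y ρ

open Classical in
/-- The outward unit normal of `B` at a boundary point `y`: the normalized gradient of any defining
function (see `outwardNormal_eq`). -/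
def outwardNormal {d : ℕ} (B : Set (Eu d)) (y : Eu d) : Eu d :=
  if h : ∃ ρ, IsDefiningFunction B y ρ then
    ‖gradient h.choose y‖⁻¹ • gradient h.choose y
  else 0

theorem IsDefiningFunction.inner_nonpos {d : ℕ} {B : Set (Eu d)} {y : Eu d} {ρ σ : Eu d → ℝ}
    (hρ : IsDefiningFunction B y ρ) (hσ : IsDefiningFunction B y σ) (hy : y ∈ frontier B)
    (v : Eu d) (hv : inner ℝ (gradient ρ y) v < 0) : inner ℝ (gradient σ y) v ≤ 0 := by
  have zero : ∀ {τ : Eu d → ℝ}, IsDefiningFunction B y τ → τ y = 0 := by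
    intro τ hτ
    obtain ⟨h1, -, h3⟩ := hτ
    rcases lt_trichotomy (τ y) 0 with h | h | h
    · exfalso
      have h4 := h1.continuous.continuousAt.eventually (gt_mem_nhds h)
      have h5 : ∀ᶠ x in 𝓝 y, x ∈ B := by
        filter_upwards [h3, h4] with x hx hx'
        exact hx.2 hx'
      exact hy.2 (mem_interior_iff_mem_nhds.2 h5)
    · exact h
    · exfalso
      have h4 := h1.continuous.continuousAt.eventually (lt_mem_nhds h)
      obtain ⟨x, hx, hx'⟩ := (mem_closure_iff_frequently.1 hy.1).and_eventually
        (h3.and h4) |>.exists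
      exact absurd (hx'.1.1 hx) (not_lt.2 hx'.2.le)
  have der : ∀ {τ : Eu d → ℝ}, IsDefiningFunction B y τ →
      HasDerivAt (fun t : ℝ => τ (y + t • v)) (inner ℝ (gradient τ y) v) 0 := by
    intro τ hτ
    have h1 : HasFDerivAt τ (InnerProductSpace.toDual ℝ (Eu d) (gradient τ y)) (y + (0 : ℝ) • v) := by
      have := ((hτ.1.differentiable (by simp)) y).hasGradientAt.hasFDerivAt
      simpa using this
    have h2 : HasDerivAt (fun t : ℝ => y + t • v) v 0 := by
      simpa using ((hasDerivAt_id (0 : ℝ)).smul_const v).const_add y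
    have h3 := h1.comp_hasDerivAt (0 : ℝ) h2
    rw [InnerProductSpace.toDual_apply_apply] at h3
    exact h3
  by_contra! hcon
  have tend : Tendsto (fun t : ℝ => y + t • v) (𝓝[>] 0) (𝓝 y) := by
    have : Continuous (fun t : ℝ => y + t • v) := by fun_prop
    simpa using (this.tendsto 0).mono_left (nhdsWithin_le_nhds (s := Set.Ioi 0))
  have sρ := (hasDerivAt_iff_tendsto_slope.1 (der hρ)).eventually (gt_mem_nhds hv)
  have sσ := (hasDerivAt_iff_tendsto_slope.1 (der hσ)).eventually (lt_mem_nhds hcon)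
  have hle : 𝓝[>] (0 : ℝ) ≤ 𝓝[≠] 0 := nhdsWithin_mono _ (fun x hx => ne_of_gt hx)
  obtain ⟨t, ⟨⟨⟨h1, h2⟩, h3⟩, h4⟩, h5⟩ := (((((sρ.filter_mono hle).and (sσ.filter_mono hle)).and
    (tend.eventually hρ.2.2)).and (tend.eventually hσ.2.2)).and self_mem_nhdsWithin).exists
  have ht : (0 : ℝ) < t := h5
  simp only [slope_def_field, zero_smul, add_zero, zero hρ, zero hσ, sub_zero] at h1 h2
  have h6 : ρ (y + t • v) < 0 := by
    by_contra! h
    exact absurd h1 (not_lt.2 (div_nonneg h ht.le))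
  have h7 : 0 < σ (y + t • v) := by
    by_contra! h
    exact absurd h2 (not_lt.2 (div_nonpos_of_nonpos_of_nonneg h ht.le))
  exact absurd (h4.1 (h3.2 h6)) (not_lt.2 h7.le)

theorem outwardNormal_eq {d : ℕ} {B : Set (Eu d)} {y : Eu d} (hy : y ∈ frontier B)
    {ρ : Eu d → ℝ} (hρ : IsDefiningFunction B y ρ) :
    outwardNormal B y = ‖gradient ρ y‖⁻¹ • gradient ρ y := by
  have h : ∃ ρ, IsDefiningFunction B y ρ := ⟨ρ, hρ⟩
  rw [outwardNormal, dif_pos h]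
  have key := hρ.inner_nonpos h.choose_spec hy
  have hb := h.choose_spec.2.1
  have ha := hρ.2.1
  generalize gradient h.choose y = b at *
  generalize gradient ρ y = a at *
  have haa : 0 < inner ℝ a a := real_inner_self_pos.2 ha
  set t : ℝ := inner ℝ a b / inner ℝ a a with ht
  set c : Eu d := b - t • a with hc
  have hac : inner ℝ a c = 0 := by
    rw [hc, inner_sub_right, inner_smul_right, ht]; field_simp; ring
  have hbc : inner ℝ b c = inner ℝ c c := by
    have : b = c + t • a := by rw [hc]; abel
    conv_lhs => rw [this]
    rw [inner_add_left, inner_smul_left, hac]; simp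
  have h1 : ∀ δ : ℝ, 0 < δ → inner ℝ c c ≤ δ * inner ℝ b a := by
    intro δ hδ
    have := key (c - δ • a) (by
      rw [inner_sub_right, inner_smul_right, hac]; nlinarith [mul_pos hδ haa])
    rw [inner_sub_right, inner_smul_right, hbc] at this
    linarith
  have hcc : inner ℝ c c ≤ 0 := by
    by_contra! hpos
    have h2 := h1 1 one_pos
    have h3 : 0 < inner ℝ b a := by linarith
    have h4 := h1 (inner ℝ c c / (2 * inner ℝ b a)) (by positivity)
    have h5 : inner ℝ c c / (2 * inner ℝ b a) * inner ℝ b a = inner ℝ c c / 2 := by field_simp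
    linarith
  have hc0 : c = 0 := by
    rw [real_inner_self_eq_norm_sq] at hcc
    exact norm_eq_zero.1 (pow_eq_zero_iff (two_ne_zero)|>.1 (le_antisymm hcc (sq_nonneg _)))
  have hbt : b = t • a := by rw [hc] at hc0; exact sub_eq_zero.1 hc0
  have ht0 : 0 ≤ t := by
    have := key (-a) (by rw [inner_neg_right]; linarith)
    rw [inner_neg_right, hbt, inner_smul_left] at this
    simp only [conj_trivial] at this
    by_contra! hneg
    nlinarith [mul_pos_of_neg_of_neg hneg (neg_lt_zero.2 haa)]
  have htp : 0 < t := lt_of_le_of_ne ht0 (by rintro h; rw [← h] at hbt; exact hb (by simpa using hbt))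
  rw [hbt, norm_smul, Real.norm_of_nonneg ht0, smul_smul]
  congr 1
  field_simp

/-- The least value of `ξ̄ · A ξ` over the complex unit vectors `ξ` (for symmetric `A`, the
smallest eigenvalue). -/
def Amin {d : ℕ} (A : Matrix (Fin d) (Fin d) ℝ) : ℝ :=
  ⨅ ξ : Metric.sphere (0 : EuclideanSpace ℂ (Fin d)) 1,
    (∑ i, ∑ j, conj (ξ.1 i) * (A i j : ℂ) * ξ.1 j).re

open Classical in
/-- The coefficient equal to `A₁` in `B` and to `A` outside `B`. -/
def coeff {d : ℕ} (A A₁ : Matrix (Fin d) (Fin d) ℝ) (B : Set (Eu d)) (y : Eu d) :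
    Matrix (Fin d) (Fin d) ℝ :=
  if y ∈ B then A₁ else A

/-- The form `∫_Ω Ã ∇u · ∇φ̄ + A_min u φ̄ dy`, for `u ∈ H¹(Ω)` and smooth `φ`. -/
def correctorForm {d : ℕ} (A A₁ : Matrix (Fin d) (Fin d) ℝ) (B Ω : Set (Eu d))
    (u φ : Eu d → ℂ) : ℂ :=
  ∫ y in Ω, ((∑ i, ∑ j, (coeff A A₁ B y i j : ℂ) * weakPartial Ω j u y * conj (partialD i φ y))
    + (Amin A : ℂ) * u y * conj (φ y))

/-- The boundary term `∫_{∂B} [(A₁ - A) p · ν] φ̄ ds` for a constant vector `p ∈ ℂᵈ`, with the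
surface measure of `∂B` (the normalized `(d-1)`-dimensional Hausdorff measure). -/
def boundaryTerm {d : ℕ} (A A₁ : Matrix (Fin d) (Fin d) ℝ) (B : Set (Eu d)) (p : Fin d → ℂ)
    (φ : Eu d → ℂ) : ℂ :=
  ∫ y in frontier B,
    (∑ i, (∑ j, ((A₁ - A) i j : ℂ) * p j) * (outwardNormal B y i : ℂ)) * conj (φ y)
      ∂(Measure.euclideanHausdorffMeasure (d - 1))

/-- The variational equation of the corrector on `Ω`, with the dense class of smooth compactly
supported test functions. -/
def CorrectorEq {d : ℕ} (A A₁ : Matrix (Fin d) (Fin d) ℝ) (B Ω : Set (Eu d)) (p : Fin d → ℂ)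
    (u : Eu d → ℂ) : Prop :=
  ∀ φ : Eu d → ℂ, IsTest Ω φ → correctorForm A A₁ B Ω u φ = boundaryTerm A A₁ B p φ

/-- `u` is the corrector on the bounded open set `Ω`, with zero Dirichlet condition:
`u ∈ H¹₀(Ω)` solves the variational equation. -/
def IsDirichletCorrector {d : ℕ} (A A₁ : Matrix (Fin d) (Fin d) ℝ) (B Ω : Set (Eu d))
    (p : Fin d → ℂ) (u : Eu d → ℂ) : Prop :=
  MemH10 Ω u ∧ CorrectorEq A A₁ B Ω p u

/-- `u` is the whole-space corrector: `u ∈ H¹(ℝᵈ)` solves the variational equation. -/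
def IsWholeSpaceCorrector {d : ℕ} (A A₁ : Matrix (Fin d) (Fin d) ℝ) (B : Set (Eu d))
    (p : Fin d → ℂ) (u : Eu d → ℂ) : Prop :=
  MemH1 Set.univ u ∧ CorrectorEq A A₁ B Set.univ p u

end

/-!
Fields of jets `(u, ∇u)` turn the corrector equation into an elliptic equation `⟪jet φ, T J⟫ = ℓ φ`
whose right-hand side `ℓ` only sees a neighbourhood of `∂B`. Outside a ball containing `B` the
whole-space corrector solves the homogeneous equation; because of the zeroth-order term, testing
with `χ w` for a cutoff `χ` with gradient `O(1/R)` gives the Caccioppoli inequality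
`E (2R) ≤ (C / R) E R` for the `H¹` energy `E R` off the ball of radius `R`, so that `E` decays
faster than every power.

The difference of the two correctors is annihilated by the equation on `ε⁻¹ D` and differs from a
member of `H¹₀(ε⁻¹ D)` only by the cut-off tail of the whole-space corrector. By Céa's lemma its
energy is at most a constant times `E (ρ / ε)`, where `D` contains the ball of radius `2 ρ` about
`0`. Rescaling to `D` costs one power of `ε⁻¹`, so the error is `o(ε ^ s)` for every `s`.
-/

open scoped ENNReal NNReal InnerProductSpace

noncomputable section

section Mollification

variable {G F : Type*} [NormedAddCommGroup G] [MeasurableSpace G] [BorelSpace G]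
  [NormedAddCommGroup F] {μ : Measure G} {p : ℝ≥0} {u : G → F}

theorem tendsto_eLpNorm_translate_sub [LocallyCompactSpace G] [μ.IsAddHaarMeasure]
    [μ.InnerRegularCompactLTTop] {p : ℝ≥0∞}
    [Fact (1 ≤ p)] (hp : p ≠ ⊤) (hu : MemLp u p μ) :
    Tendsto (fun z => eLpNorm (fun x => u (x - z) - u x) p μ) (𝓝 0) (𝓝 0) := by
  let T : C(G, C(G, G)) := (ContinuousMap.mk (fun a : G × G => a.2 - a.1) (by fun_prop)).curry
  have hT : ∀ z, MeasurePreserving (T z) μ μ := fun z => measurePreserving_sub_right μ z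
  have h := Filter.Tendsto.compMeasurePreservingLp (f := fun _ : G => hu.toLp u)
    tendsto_const_nhds (T.continuous.tendsto 0) hT (hT 0) hp
  rw [Lp.tendsto_Lp_iff_tendsto_eLpNorm'] at h
  refine h.congr fun z => eLpNorm_congr_ae ?_
  rw [Lp.toLp_compMeasurePreserving hu (hT z), Lp.toLp_compMeasurePreserving hu (hT 0)]
  filter_upwards [(hu.comp_measurePreserving (hT z)).coeFn_toLp,
    (hu.comp_measurePreserving (hT 0)).coeFn_toLp] with x hz h0
  simp [hz, h0, T]

variable [NormedSpace ℝ G] [FiniteDimensional ℝ G] [HasContDiffBump G] [μ.IsAddHaarMeasure]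

theorem lintegral_ofReal_normed_eq_one (ρ : ContDiffBump (0 : G)) :
    ∫⁻ z, ENNReal.ofReal (ρ.normed μ z) ∂μ = 1 := by
  rw [← ofReal_integral_eq_lintegral_ofReal ρ.integrable_normed
    (Eventually.of_forall ρ.nonneg_normed), ρ.integral_normed, ENNReal.ofReal_one]

variable [NormedSpace ℝ F]

variable (μ) in
/-- The mollification of `u` by a normalized bump function. -/
abbrev mollify (ρ : ContDiffBump (0 : G)) (u : G → F) : G → F :=
  convolution (ρ.normed μ) u (ContinuousLinearMap.lsmul ℝ ℝ) μ

theorem mollify_sub_apply_eq_integral [CompleteSpace F] (hu : LocallyIntegrable u μ)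
    (ρ : ContDiffBump (0 : G)) (x : G) :
    mollify μ ρ u x - u x = ∫ z, ρ.normed μ z • (u (x - z) - u x) ∂μ := by
  have hconv : Integrable (fun z => ρ.normed μ z • u (x - z)) μ :=
    ρ.hasCompactSupport_normed.convolutionExists_left (ContinuousLinearMap.lsmul ℝ ℝ)
      ρ.continuous_normed hu x
  simp_rw [smul_sub]
  rw [integral_sub hconv (ρ.integrable_normed.smul_const (u x)), integral_smul_const,
    ρ.integral_normed, one_smul]
  rfl

theorem enorm_mollify_sub_rpow_le [CompleteSpace F] (hp : 1 ≤ p) (hu : MemLp u p μ)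
    (ρ : ContDiffBump (0 : G)) (x : G) :
    ‖mollify μ ρ u x - u x‖ₑ ^ (p : ℝ) ≤
      ∫⁻ z, ENNReal.ofReal (ρ.normed μ z) * ‖u (x - z) - u x‖ₑ ^ (p : ℝ) ∂μ := by
  have hw : Measurable fun z => ENNReal.ofReal (ρ.normed μ z) :=
    ρ.continuous_normed.measurable.ennreal_ofReal
  set ν := μ.withDensity fun z => ENNReal.ofReal (ρ.normed μ z) with hν
  have : IsProbabilityMeasure ν := ⟨by
    rw [hν, withDensity_apply _ MeasurableSet.univ, Measure.restrict_univ,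
      lintegral_ofReal_normed_eq_one]⟩
  have hmeas : AEStronglyMeasurable (fun z => u (x - z) - u x) μ :=
    (hu.1.comp_measurePreserving (Measure.measurePreserving_sub_left μ x)).sub
      aestronglyMeasurable_const
  have hle : ‖mollify μ ρ u x - u x‖ₑ ≤ eLpNorm (fun z => u (x - z) - u x) 1 ν := by
    rw [mollify_sub_apply_eq_integral (hu.locallyIntegrable (mod_cast hp))]
    refine (enorm_integral_le_lintegral_enorm _).trans_eq ?_
    rw [eLpNorm_one_eq_lintegral_enorm, hν,
      lintegral_withDensity_eq_lintegral_mul₀ hw.aemeasurable hmeas.enorm]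
    refine lintegral_congr fun z => ?_
    rw [enorm_smul, Real.enorm_of_nonneg (ρ.nonneg_normed z)]
    rfl
  calc ‖mollify μ ρ u x - u x‖ₑ ^ (p : ℝ)
      ≤ eLpNorm (fun z => u (x - z) - u x) p ν ^ (p : ℝ) := by
        gcongr
        exact hle.trans (eLpNorm_le_eLpNorm_of_exponent_le (mod_cast hp)
          (hmeas.mono_ac (withDensity_absolutelyContinuous _ _)))
    _ = _ := by
        rw [eLpNorm_nnreal_pow_eq_lintegral (by positivity), hν,
          lintegral_withDensity_eq_lintegral_mul₀ hw.aemeasurable (hmeas.enorm.pow_const _)]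
        rfl

theorem eLpNorm_mollify_sub_le [CompleteSpace F] (hp : 1 ≤ p) (hu : MemLp u p μ)
    (ρ : ContDiffBump (0 : G)) {δ : ℝ≥0∞}
    (hδ : ∀ z ∈ Metric.ball 0 ρ.rOut, eLpNorm (fun x => u (x - z) - u x) p μ ≤ δ) :
    eLpNorm (fun x => mollify μ ρ u x - u x) p μ ≤ δ := by
  have hw : Measurable fun z => ENNReal.ofReal (ρ.normed μ z) :=
    ρ.continuous_normed.measurable.ennreal_ofReal
  have hmeas : AEMeasurable (Function.uncurry fun x z =>
      ENNReal.ofReal (ρ.normed μ z) * ‖u (x - z) - u x‖ₑ ^ (p : ℝ)) (μ.prod μ) :=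
    (hw.comp measurable_snd).aemeasurable.mul
      (((hu.1.comp_quasiMeasurePreserving (quasiMeasurePreserving_sub μ μ)).sub
        hu.1.comp_fst).enorm.pow_const _)
  refine (ENNReal.rpow_le_rpow_iff (z := p) (by positivity)).1 ?_
  rw [eLpNorm_nnreal_pow_eq_lintegral (by positivity)]
  calc _ ≤ ∫⁻ x, ∫⁻ z, ENNReal.ofReal (ρ.normed μ z) * ‖u (x - z) - u x‖ₑ ^ (p : ℝ) ∂μ ∂μ :=
        lintegral_mono fun x => enorm_mollify_sub_rpow_le hp hu ρ x
    _ = ∫⁻ z, ENNReal.ofReal (ρ.normed μ z) * ∫⁻ x, ‖u (x - z) - u x‖ₑ ^ (p : ℝ) ∂μ ∂μ := by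
        rw [lintegral_lintegral_swap hmeas]
        exact lintegral_congr fun z => lintegral_const_mul' _ _ ENNReal.ofReal_ne_top
    _ ≤ ∫⁻ z, ENNReal.ofReal (ρ.normed μ z) * δ ^ (p : ℝ) ∂μ := by
        refine lintegral_mono fun z => ?_
        rw [← eLpNorm_nnreal_pow_eq_lintegral (by positivity)]
        by_cases hz : z ∈ Metric.ball (0 : G) ρ.rOut
        · gcongr
          exact hδ z hz
        · rw [← ρ.support_normed_eq (μ := μ), Function.notMem_support] at hz
          simp [hz]
    _ = δ ^ (p : ℝ) := by
        rw [lintegral_mul_const _ hw, lintegral_ofReal_normed_eq_one, one_mul]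

theorem exists_eLpNorm_mollify_sub_le [CompleteSpace F] (hp : 1 ≤ p) (hu : MemLp u p μ)
    {δ : ℝ≥0∞} (hδ : 0 < δ) :
    ∃ ρ : ContDiffBump (0 : G), eLpNorm (fun x => mollify μ ρ u x - u x) p μ ≤ δ := by
  have : Fact (1 ≤ (p : ℝ≥0∞)) := ⟨mod_cast hp⟩
  have h := ENNReal.tendsto_nhds_zero.1
    (tendsto_eLpNorm_translate_sub ENNReal.coe_ne_top hu) δ hδ
  obtain ⟨r, hr, hball⟩ := Metric.eventually_nhds_iff_ball.1 h
  exact ⟨⟨r / 2, r, half_pos hr, half_lt_self hr⟩, eLpNorm_mollify_sub_le hp hu _ hball⟩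

end Mollification

section TestFunctions

variable {d : ℕ} {F : Type*} [NormedAddCommGroup F] [NormedSpace ℝ F] {Ω Ω' : Set (Eu d)}
  {f φ : Eu d → F} {χ : Eu d → ℝ}

theorem continuous_partialD (hf : ContDiff ℝ ∞ f) (i : Fin d) : Continuous (partialD i f) :=
  (hf.continuous_fderiv (by simp)).clm_apply continuous_const

theorem hasCompactSupport_partialD (hf : HasCompactSupport f) (i : Fin d) :
    HasCompactSupport (partialD i f) :=
  hf.fderiv_apply (𝕜 := ℝ) _

theorem partialD_smul {x : Eu d} (hχ : DifferentiableAt ℝ χ x) (hf : DifferentiableAt ℝ f x)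
    (i : Fin d) :
    partialD i (fun y => χ y • f y) x = χ x • partialD i f x + partialD i χ x • f x := by
  simp [partialD, fderiv_fun_smul hχ hf]

theorem partialD_comp_smul (c : ℝ) (i : Fin d) (x : Eu d) :
    partialD i (fun y => f (c • y)) x = c • partialD i f (c • x) := by
  simp [partialD, fderiv_comp_smul]

theorem partialD_comp_const_sub {x y : Eu d} (hf : DifferentiableAt ℝ f (x - y)) (i : Fin d) :
    partialD i (fun y => f (x - y)) y = -partialD i f (x - y) := by
  have h : HasFDerivAt (fun y => f (x - y)) _ y :=
    hf.hasFDerivAt.comp y ((hasFDerivAt_id y).const_sub x)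
  simp [partialD, h.fderiv]

theorem sum_sq_partialD_eq (χ : Eu d → ℝ) (y : Eu d) :
    ∑ i, partialD i χ y ^ 2 = ‖fderiv ℝ χ y‖ ^ 2 := by
  rw [← (InnerProductSpace.toDual ℝ (Eu d)).symm.norm_map, EuclideanSpace.norm_sq_eq]
  refine Finset.sum_congr rfl fun i _ => ?_
  rw [Real.norm_eq_abs, sq_abs, partialD, ← InnerProductSpace.toDual_symm_apply,
    EuclideanSpace.inner_single_right]
  simp

theorem IsTest.mono (h : IsTest Ω φ) (hs : Ω ⊆ Ω') : IsTest Ω' φ :=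
  ⟨h.1, h.2.1, h.2.2.trans hs⟩

theorem IsTest.eq_zero (h : IsTest Ω φ) {x : Eu d} (hx : x ∉ Ω) : φ x = 0 :=
  image_eq_zero_of_notMem_tsupport fun h' => hx (h.2.2 h')

theorem IsTest.partialD (h : IsTest Ω φ) (i : Fin d) : IsTest Ω (partialD i φ) :=
  ⟨h.1.fderiv_right (m := ∞) (by simp) |>.clm_apply contDiff_const,
    hasCompactSupport_partialD h.2.1 i, (tsupport_fderiv_apply_subset ℝ _).trans h.2.2⟩

theorem IsTest.smul (hφ : IsTest Ω φ) (hχ : ContDiff ℝ ∞ χ) (hs : tsupport χ ⊆ Ω') :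
    IsTest Ω' (fun y => χ y • φ y) :=
  ⟨hχ.smul hφ.1, hφ.2.1.smul_left, (tsupport_smul_subset_left χ φ).trans hs⟩

theorem IsTest.comp_inv_smul {c : ℝ} (hc : c ≠ 0) (h : IsTest Ω φ) :
    IsTest (c • Ω) (fun x => φ (c⁻¹ • x)) := by
  refine ⟨h.1.comp (by fun_prop),
    h.2.1.comp_homeomorph (Homeomorph.smulOfNeZero c⁻¹ (inv_ne_zero hc)), fun x hx => ?_⟩
  exact (Set.mem_smul_set_iff_inv_smul_mem₀ hc _ _).2
    (h.2.2 (tsupport_comp_subset_preimage φ (f := fun x : Eu d => c⁻¹ • x) (by fun_prop) hx))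

theorem IsTest.memLp (h : IsTest Ω φ) (p : ℝ≥0∞) (μ : Measure (Eu d))
    [IsFiniteMeasureOnCompacts μ] : MemLp φ p μ :=
  h.1.continuous.memLp_of_hasCompactSupport h.2.1

theorem IsTest.integrable_smul {φ : Eu d → ℝ} {u : Eu d → F} {μ : Measure (Eu d)}
    [IsFiniteMeasureOnCompacts μ] (h : IsTest Ω φ) (hu : MemLp u 2 μ) :
    Integrable (fun x => φ x • u x) μ :=
  memLp_one_iff_integrable.1 (hu.smul (h.memLp 2 μ))

theorem IsTest.setIntegral_smul_eq {φ : Eu d → ℝ} (h : IsTest Ω φ) (hs : Ω ⊆ Ω') (u : Eu d → F) :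
    ∫ x in Ω', φ x • u x = ∫ x in Ω, φ x • u x := by
  rw [setIntegral_eq_integral_of_forall_compl_eq_zero (s := Ω),
    setIntegral_eq_integral_of_forall_compl_eq_zero]
  · intro x hx
    rw [h.eq_zero fun h' => hx (hs h'), zero_smul]
  · intro x hx
    rw [h.eq_zero hx, zero_smul]

end TestFunctions

section WeakDerivatives

variable {d : ℕ} {Ω Ω' : Set (Eu d)} {i : Fin d} {u v g g' : Eu d → ℂ}

theorem HasWeakPartial.mono (h : HasWeakPartial Ω' i u g) (hs : Ω ⊆ Ω') :
    HasWeakPartial Ω i u g := by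
  refine ⟨h.1.mono_measure (Measure.restrict_mono_set _ hs), fun φ hφ => ?_⟩
  rw [← (hφ.partialD i).setIntegral_smul_eq hs, ← hφ.setIntegral_smul_eq hs]
  exact h.2 φ (hφ.mono hs)

theorem HasWeakPartial.ae_eq (hΩ : IsOpen Ω) (h : HasWeakPartial Ω i u g)
    (h' : HasWeakPartial Ω i u g') : g =ᵐ[volume.restrict Ω] g' := by
  have hloc : LocallyIntegrableOn (g - g') Ω volume :=
    locallyIntegrableOn_of_locallyIntegrable_restrict
      ((h.1.sub h'.1).locallyIntegrable (by norm_num))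
  have hzero := hΩ.ae_eq_zero_of_integral_contDiff_smul_eq_zero hloc fun φ hφ hc hs => by
    have ht : IsTest Ω φ := ⟨hφ, hc, hs⟩
    rw [← setIntegral_univ, ht.setIntegral_smul_eq (Set.subset_univ Ω)]
    simp only [Pi.sub_apply, smul_sub]
    rw [integral_sub (ht.integrable_smul h.1) (ht.integrable_smul h'.1), sub_eq_zero]
    exact neg_injective ((h.2 φ ht).symm.trans (h'.2 φ ht))
  rw [Filter.EventuallyEq, ae_restrict_iff' hΩ.measurableSet]
  filter_upwards [hzero] with x hx hxΩ
  exact sub_eq_zero.1 (hx hxΩ)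

theorem HasWeakPartial.sub (hu : MemLp u 2 (volume.restrict Ω))
    (hv : MemLp v 2 (volume.restrict Ω)) (h : HasWeakPartial Ω i u g)
    (h' : HasWeakPartial Ω i v g') :
    HasWeakPartial Ω i (fun x => u x - v x) (fun x => g x - g' x) := by
  refine ⟨h.1.sub h'.1, fun φ hφ => ?_⟩
  simp only [smul_sub]
  rw [integral_sub ((hφ.partialD i).integrable_smul hu) ((hφ.partialD i).integrable_smul hv),
    integral_sub (hφ.integrable_smul h.1) (hφ.integrable_smul h'.1), h.2 φ hφ, h'.2 φ hφ]
  ring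

theorem HasWeakPartial.of_isTest {φ : Eu d → ℂ} (hφ : IsTest Ω' φ) (Ω : Set (Eu d)) (i : Fin d) :
    HasWeakPartial Ω i φ (partialD i φ) := by
  refine ⟨(hφ.partialD i).memLp 2 _, fun χ hχ => ?_⟩
  rw [← hχ.setIntegral_smul_eq (Set.subset_univ Ω),
    ← (hχ.partialD i).setIntegral_smul_eq (Set.subset_univ Ω), setIntegral_univ, setIntegral_univ]
  have hparts := integral_smul_fderiv_eq_neg_fderiv_smul_of_integrable
    (v := EuclideanSpace.single i 1)
    ((hχ.partialD i).integrable_smul (hφ.memLp 2 volume))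
    (hχ.integrable_smul ((hφ.partialD i).memLp 2 volume))
    (hχ.integrable_smul (hφ.memLp 2 volume))
    (fun x _ => (hχ.1.differentiable (by simp)) x) (fun x _ => (hφ.1.differentiable (by simp)) x)
  exact (neg_eq_iff_eq_neg.2 hparts).symm

theorem memLp_comp_const_smul {c : ℝ} (hc : 0 < c)
    (h : MemLp u 2 (volume.restrict (c • Ω))) :
    MemLp (fun x => u (c • x)) 2 (volume.restrict Ω) := by
  have he : MeasurableEmbedding (fun x : Eu d => c • x) :=
    (Homeomorph.smulOfNeZero c hc.ne').measurableEmbedding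
  have hpre : (fun x : Eu d => c • x) ⁻¹' (c • Ω) = Ω := by
    rw [← Set.image_smul]
    exact Set.preimage_image_eq _ (smul_right_injective _ hc.ne')
  refine MemLp.comp_of_map (f := fun x => c • x) ?_ (by fun_prop)
  rw [← hpre, ← he.restrict_map, Measure.map_addHaar_smul volume hc.ne', Measure.restrict_smul]
  exact h.smul_measure ENNReal.ofReal_ne_top

theorem HasWeakPartial.comp_smul {c : ℝ} (hc : 0 < c) (h : HasWeakPartial (c • Ω) i u g) :
    HasWeakPartial Ω i (fun x => u (c • x)) (fun x => c • g (c • x)) := by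
  refine ⟨(memLp_comp_const_smul hc h.1).const_smul c, fun φ hφ => ?_⟩
  have hparts := h.2 _ (hφ.comp_inv_smul hc.ne')
  have hleft := Measure.setIntegral_comp_smul_of_pos volume
    (fun x => partialD i (fun x => φ (c⁻¹ • x)) x • u x) Ω hc
  have hright := Measure.setIntegral_comp_smul_of_pos volume
    (fun x => φ (c⁻¹ • x) • g x) Ω hc
  rw [hparts, smul_neg, ← hright] at hleft
  simp only [partialD_comp_smul, inv_smul_smul₀ hc.ne'] at hleft
  calc ∫ x in Ω, partialD i φ x • u (c • x)
      = c • ∫ x in Ω, (c⁻¹ • partialD i φ x) • u (c • x) := by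
        simp_rw [← integral_smul, smul_assoc, smul_inv_smul₀ hc.ne']
    _ = -∫ x in Ω, φ x • c • g (c • x) := by
        simp_rw [hleft, smul_neg, ← integral_smul, smul_comm c]

theorem MemH1.hasWeakPartial (h : MemH1 Ω u) (i : Fin d) :
    HasWeakPartial Ω i u (weakPartial Ω i u) := by
  rw [weakPartial, dif_pos (h.2 i)]
  exact (h.2 i).choose_spec

theorem HasWeakPartial.weakPartial_ae_eq (hΩ : IsOpen Ω) (h : HasWeakPartial Ω i u g) :
    weakPartial Ω i u =ᵐ[volume.restrict Ω] g := by
  rw [weakPartial, dif_pos ⟨g, h⟩]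
  exact (Exists.choose_spec ⟨g, h⟩ : HasWeakPartial Ω i u _).ae_eq hΩ h

theorem MemH1.mono (h : MemH1 Ω' u) (hs : Ω ⊆ Ω') : MemH1 Ω u :=
  ⟨h.1.mono_measure (Measure.restrict_mono_set _ hs),
    fun i => ⟨_, (h.hasWeakPartial i).mono hs⟩⟩

theorem MemH1.sub (hu : MemH1 Ω u) (hv : MemH1 Ω v) : MemH1 Ω (fun x => u x - v x) :=
  ⟨hu.1.sub hv.1, fun i => ⟨_, (hu.hasWeakPartial i).sub hu.1 hv.1 (hv.hasWeakPartial i)⟩⟩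

theorem MemH1.of_isTest {φ : Eu d → ℂ} (hφ : IsTest Ω' φ) (Ω : Set (Eu d)) : MemH1 Ω φ :=
  ⟨hφ.memLp 2 _, fun i => ⟨_, HasWeakPartial.of_isTest hφ Ω i⟩⟩

theorem MemH1.comp_smul {c : ℝ} (hc : 0 < c) (h : MemH1 (c • Ω) u) :
    MemH1 Ω (fun x => u (c • x)) :=
  ⟨memLp_comp_const_smul hc h.1, fun i => ⟨_, (h.hasWeakPartial i).comp_smul hc⟩⟩

end WeakDerivatives

section Jets

/-- The space of first-order jets of complex functions: a value together with a gradient. With the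
`ℓ²` norm, `‖J‖ ^ 2` is the `H¹` energy density and the inner product is the `H¹` pairing. -/
abbrev Jet (d : ℕ) : Type := WithLp 2 (ℂ × EuclideanSpace ℂ (Fin d))

/-- The jet with value `a` and gradient `ξ`. -/
def jet {d : ℕ} (a : ℂ) (ξ : Fin d → ℂ) : Jet d := WithLp.toLp 2 (a, WithLp.toLp 2 ξ)

/-- The field of jets of a differentiable function. -/
def classicalJet {d : ℕ} (φ : Eu d → ℂ) (y : Eu d) : Jet d := jet (φ y) fun i => partialD i φ y

/-- The field of jets of a function in `H¹(Ω)`, formed with its weak derivatives. -/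
def weakJet {d : ℕ} (Ω : Set (Eu d)) (u : Eu d → ℂ) (y : Eu d) : Jet d :=
  jet (u y) fun i => weakPartial Ω i u y

/-- Multiplication of a field of jets by a real function, according to the product rule. -/
def jetMul {d : ℕ} (χ : Eu d → ℝ) (J : Eu d → Jet d) (y : Eu d) : Jet d :=
  χ y • J y + (J y).fst • jet 0 fun i => ((partialD i χ y : ℝ) : ℂ)

variable {d : ℕ} {Ω Ω' : Set (Eu d)} {u v φ : Eu d → ℂ} {χ β : Eu d → ℝ} {J J' : Eu d → Jet d}
  {y : Eu d}

theorem norm_sq_jet (a : ℂ) (ξ : Fin d → ℂ) : ‖jet a ξ‖ ^ 2 = ‖a‖ ^ 2 + ∑ i, ‖ξ i‖ ^ 2 := by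
  simp [jet, WithLp.prod_norm_sq_eq_of_L2, EuclideanSpace.norm_sq_eq]

theorem Jet.ext {J J' : Jet d} (h₀ : J.fst = J'.fst) (h : ∀ i, J.snd i = J'.snd i) : J = J' :=
  WithLp.ofLp_injective 2 (Prod.ext h₀ (PiLp.ext h))

theorem memLp_jet_iff {α : Type*} [MeasurableSpace α] {μ : Measure α} {p : ℝ≥0∞} {a : α → ℂ}
    {ξ : α → Fin d → ℂ} :
    MemLp (fun x => jet (a x) (ξ x)) p μ ↔ MemLp a p μ ∧ ∀ i, MemLp (ξ · i) p μ := by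
  simp only [jet, memLp_prodLp_iff, memLp_piLp_iff]
  rfl

theorem continuous_jet {X : Type*} [TopologicalSpace X] {a : X → ℂ} {ξ : X → Fin d → ℂ}
    (ha : Continuous a) (hξ : ∀ i, Continuous (ξ · i)) : Continuous fun x => jet (a x) (ξ x) :=
  (WithLp.prod_continuous_toLp ..).comp
    (ha.prodMk ((PiLp.continuous_toLp 2 _).comp (continuous_pi hξ)))

theorem continuous_classicalJet (hφ : ContDiff ℝ ∞ φ) : Continuous (classicalJet φ) :=
  continuous_jet hφ.continuous fun i => continuous_partialD hφ i

theorem IsTest.memLp_classicalJet (hφ : IsTest Ω φ) (p : ℝ≥0∞) (μ : Measure (Eu d))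
    [IsFiniteMeasureOnCompacts μ] : MemLp (classicalJet φ) p μ :=
  memLp_jet_iff.2 ⟨hφ.memLp p μ, fun i => (hφ.partialD i).memLp p μ⟩

theorem IsTest.classicalJet_eq_zero (hφ : IsTest Ω φ) (hy : y ∉ Ω) : classicalJet φ y = 0 := by
  simp only [classicalJet, hφ.eq_zero hy, (hφ.partialD _).eq_zero hy]
  rfl

theorem classicalJet_smul (hχ : DifferentiableAt ℝ χ y) (hφ : DifferentiableAt ℝ φ y) :
    classicalJet (fun x => χ x • φ x) y = jetMul χ (classicalJet φ) y := by
  simp only [classicalJet, jetMul, jet, partialD_smul hχ hφ]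
  refine Jet.ext ?_ fun i => ?_ <;> simp [mul_comm]

theorem norm_jetMul_sub_smul_le (χ : Eu d → ℝ) (J : Eu d → Jet d) (y : Eu d) :
    ‖jetMul χ J y - χ y • J y‖ ≤ ‖fderiv ℝ χ y‖ * ‖J y‖ := by
  have hgrad : ‖(jet 0 fun i => ((partialD i χ y : ℝ) : ℂ) : Jet d)‖ = ‖fderiv ℝ χ y‖ := by
    refine (sq_eq_sq₀ (norm_nonneg _) (norm_nonneg _)).1 ?_
    simp [norm_sq_jet, ← sum_sq_partialD_eq]
  rw [jetMul, add_sub_cancel_left, norm_smul, hgrad, mul_comm]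
  gcongr
  exact WithLp.norm_fst_le ℂ (J y)

theorem norm_jetMul_le (χ : Eu d → ℝ) (J : Eu d → Jet d) (y : Eu d) :
    ‖jetMul χ J y‖ ≤ (|χ y| + ‖fderiv ℝ χ y‖) * ‖J y‖ :=
  calc ‖jetMul χ J y‖ ≤ ‖χ y • J y‖ + ‖jetMul χ J y - χ y • J y‖ :=
        norm_le_norm_add_norm_sub' _ _
    _ ≤ |χ y| * ‖J y‖ + ‖fderiv ℝ χ y‖ * ‖J y‖ := by
        rw [norm_smul, Real.norm_eq_abs]
        gcongr
        exact norm_jetMul_sub_smul_le χ J y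
    _ = (|χ y| + ‖fderiv ℝ χ y‖) * ‖J y‖ := (add_mul ..).symm

theorem jetMul_sub (χ : Eu d → ℝ) (J J' : Eu d → Jet d) :
    jetMul χ (fun y => J y - J' y) = fun y => jetMul χ J y - jetMul χ J' y := by
  ext1 y
  simp only [jetMul, WithLp.sub_fst]
  rw [smul_sub, sub_smul]
  abel

theorem jetMul_one_sub (β : Eu d → ℝ) (J : Eu d → Jet d) :
    jetMul (1 - β) J = fun y => J y - jetMul β J y := by
  ext1 y
  have hneg : (jet 0 fun i => ((partialD i (1 - β) y : ℝ) : ℂ) : Jet d) =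
      -jet 0 fun i => ((partialD i β y : ℝ) : ℂ) := by
    rw [show 1 - β = fun x => 1 - β x from rfl]
    refine Jet.ext ?_ fun i => ?_ <;> simp [jet, partialD, fderiv_const_sub]
  simp only [jetMul, hneg, Pi.sub_apply, Pi.one_apply, sub_smul, one_smul, smul_neg]
  abel

theorem jetMul_apply_of_eventuallyEq {c : ℝ} (h : χ =ᶠ[𝓝 y] fun _ => c) :
    jetMul χ J y = c • J y := by
  have hzero : (jet 0 fun i => ((partialD i χ y : ℝ) : ℂ) : Jet d) = 0 :=
    Jet.ext rfl fun i => by simp [jet, partialD, h.fderiv_eq]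
  rw [jetMul, hzero, h.eq_of_nhds, smul_zero, add_zero]

theorem aestronglyMeasurable_jetMul {μ : Measure (Eu d)} (hJ : AEStronglyMeasurable J μ)
    (hχ : ContDiff ℝ ∞ χ) : AEStronglyMeasurable (jetMul χ J) μ := by
  refine (hχ.continuous.aestronglyMeasurable.smul hJ).add
    (((WithLp.continuous_fst 2 ℂ _).comp_aestronglyMeasurable hJ).smul ?_)
  exact (continuous_jet continuous_const fun i =>
    Complex.continuous_ofReal.comp (continuous_partialD hχ i)).aestronglyMeasurable

theorem eLpNorm_jetMul_le {μ : Measure (Eu d)} {C : ℝ} (hC : ∀ y, |χ y| + ‖fderiv ℝ χ y‖ ≤ C)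
    (J : Eu d → Jet d) (p : ℝ≥0∞) :
    eLpNorm (jetMul χ J) p μ ≤ ENNReal.ofReal C * eLpNorm J p μ :=
  eLpNorm_le_mul_eLpNorm_of_ae_le_mul (Eventually.of_forall fun y =>
    (norm_jetMul_le χ J y).trans (mul_le_mul_of_nonneg_right (hC y) (norm_nonneg _))) p

theorem memLp_jetMul {μ : Measure (Eu d)} {p : ℝ≥0∞} {C : ℝ} (hJ : MemLp J p μ)
    (hχ : ContDiff ℝ ∞ χ) (hC : ∀ y, |χ y| + ‖fderiv ℝ χ y‖ ≤ C) : MemLp (jetMul χ J) p μ :=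
  ⟨aestronglyMeasurable_jetMul hJ.1 hχ,
    (eLpNorm_jetMul_le hC J p).trans_lt (ENNReal.mul_lt_top ENNReal.ofReal_lt_top hJ.2)⟩

theorem MemH1.memLp_weakJet (h : MemH1 Ω u) : MemLp (weakJet Ω u) 2 (volume.restrict Ω) :=
  memLp_jet_iff.2 ⟨h.1, fun i => (h.hasWeakPartial i).1⟩

theorem MemH1.sq_h1Norm (h : MemH1 Ω u) : h1Norm Ω u ^ 2 = ∫ x in Ω, ‖weakJet Ω u x‖ ^ 2 := by
  have hint : ∀ i ∈ Finset.univ, IntegrableOn (fun x => ‖weakPartial Ω i u x‖ ^ 2) Ω :=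
    fun i _ => (h.hasWeakPartial i).1.integrable_norm_pow two_ne_zero
  simp only [weakJet, norm_sq_jet]
  rw [h1Norm, Real.sq_sqrt (by positivity), ← integral_finsetSum _ hint,
    ← integral_add (h.1.integrable_norm_pow two_ne_zero) (integrable_finsetSum _ hint)]

theorem MemH1.eLpNorm_weakJet (h : MemH1 Ω u) :
    eLpNorm (weakJet Ω u) 2 (volume.restrict Ω) = ENNReal.ofReal (h1Norm Ω u) := by
  rw [h.memLp_weakJet.eLpNorm_eq_integral_rpow_norm two_ne_zero ENNReal.ofNat_ne_top]
  simp only [ENNReal.toReal_ofNat, Real.rpow_ofNat]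
  rw [← h.sq_h1Norm]
  exact congrArg _ (Real.pow_rpow_inv_natCast (Real.sqrt_nonneg _) two_ne_zero)

theorem weakJet_ae_eq {G : Fin d → Eu d → ℂ} (hΩ : IsOpen Ω)
    (h : ∀ i, HasWeakPartial Ω i u (G i)) :
    weakJet Ω u =ᵐ[volume.restrict Ω] fun x => jet (u x) fun i => G i x := by
  filter_upwards [ae_all_iff.2 fun i => (h i).weakPartial_ae_eq hΩ] with x hx
  simp only [weakJet, hx]

theorem MemH1.weakJet_mono_ae_eq (h : MemH1 Ω' u) (hΩ : IsOpen Ω) (hs : Ω ⊆ Ω') :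
    weakJet Ω u =ᵐ[volume.restrict Ω] weakJet Ω' u :=
  weakJet_ae_eq hΩ fun i => (h.hasWeakPartial i).mono hs

theorem IsTest.weakJet_ae_eq (hφ : IsTest Ω' φ) (hΩ : IsOpen Ω) :
    weakJet Ω φ =ᵐ[volume.restrict Ω] classicalJet φ :=
  _root_.weakJet_ae_eq hΩ fun i => HasWeakPartial.of_isTest hφ Ω i

theorem MemH1.weakJet_sub_ae_eq (hu : MemH1 Ω u) (hv : MemH1 Ω v) (hΩ : IsOpen Ω) :
    weakJet Ω (fun x => u x - v x) =ᵐ[volume.restrict Ω]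
      fun x => weakJet Ω u x - weakJet Ω v x :=
  weakJet_ae_eq hΩ fun i => (hu.hasWeakPartial i).sub hu.1 hv.1 (hv.hasWeakPartial i)

end Jets

section Cutoff

variable {G : Type*} [NormedAddCommGroup G] [NormedSpace ℝ G] [HasContDiffBump G] {R : ℝ} {y : G}

/-- A smooth cutoff equal to `1` on the ball of radius `R` and to `0` off the ball of radius `2R`:
the dilation of a fixed bump function, so that its gradient is `O(1/R)`. -/
def cutoff (R : ℝ) (y : G) : ℝ := (⟨1, 2, one_pos, one_lt_two⟩ : ContDiffBump (0 : G)) (R⁻¹ • y)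

theorem contDiff_cutoff (R : ℝ) : ContDiff ℝ ∞ (cutoff R : G → ℝ) :=
  (ContDiffBump.contDiff _).comp (by fun_prop)

theorem cutoff_nonneg (R : ℝ) (y : G) : 0 ≤ cutoff R y := ContDiffBump.nonneg _

theorem cutoff_le_one (R : ℝ) (y : G) : cutoff R y ≤ 1 := ContDiffBump.le_one _

theorem cutoff_eventuallyEq_one (hR : 0 < R) (hy : ‖y‖ < R) : cutoff R =ᶠ[𝓝 y] fun _ => 1 := by
  filter_upwards [continuous_norm.continuousAt.eventually (gt_mem_nhds hy)] with z hz
  refine ContDiffBump.one_of_mem_closedBall _ ?_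
  simpa [norm_smul, abs_of_pos hR, inv_mul_le_iff₀ hR] using hz.le

theorem cutoff_eq_zero (hR : 0 < R) (hy : 2 * R ≤ ‖y‖) : cutoff R y = 0 := by
  refine ContDiffBump.zero_of_le_dist _ ?_
  simpa [norm_smul, abs_of_pos hR, le_inv_mul_iff₀ hR, mul_comm] using hy

theorem tsupport_cutoff_subset (hR : 0 < R) :
    tsupport (cutoff R : G → ℝ) ⊆ Metric.closedBall 0 (2 * R) := by
  refine closure_minimal (fun y hy => ?_) Metric.isClosed_closedBall
  by_contra hy'
  exact hy (cutoff_eq_zero hR (by simpa using (not_le.1 fun h => hy' (by simpa using h)).le))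

theorem tsupport_one_sub_cutoff_subset (hR : 0 < R) :
    tsupport (1 - cutoff R : G → ℝ) ⊆ (Metric.ball 0 R)ᶜ := by
  refine closure_minimal (fun y hy hy' => hy ?_) Metric.isOpen_ball.isClosed_compl
  simp [(cutoff_eventuallyEq_one hR (mem_ball_zero_iff.1 hy')).eq_of_nhds]

theorem abs_cutoff_add_norm_fderiv_le {L : ℝ} (hL : ‖fderiv ℝ (cutoff R) y‖ ≤ L) :
    |cutoff R y| + ‖fderiv ℝ (cutoff R) y‖ ≤ 1 + L :=
  add_le_add ((abs_of_nonneg (cutoff_nonneg R y)).trans_le (cutoff_le_one R y)) hL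

theorem norm_fderiv_one_sub_cutoff (R : ℝ) (y : G) :
    ‖fderiv ℝ (1 - cutoff R) y‖ = ‖fderiv ℝ (cutoff R) y‖ := by
  rw [show (1 - cutoff R : G → ℝ) = fun y => 1 - cutoff R y from rfl, fderiv_const_sub, norm_neg]

theorem abs_one_sub_cutoff_add_norm_fderiv_le {L : ℝ} (hL : ‖fderiv ℝ (cutoff R) y‖ ≤ L) :
    |(1 - cutoff R : G → ℝ) y| + ‖fderiv ℝ (1 - cutoff R) y‖ ≤ 1 + L := by
  rw [norm_fderiv_one_sub_cutoff]
  exact add_le_add (abs_le.2 ⟨by simp; linarith [cutoff_le_one R y],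
    by simpa using cutoff_nonneg R y⟩) hL

variable (G) in
theorem exists_norm_fderiv_cutoff_le [FiniteDimensional ℝ G] :
    ∃ L : ℝ, 0 ≤ L ∧ ∀ R : ℝ, 0 < R → ∀ y : G, ‖fderiv ℝ (cutoff R) y‖ ≤ L / R := by
  let b : ContDiffBump (0 : G) := ⟨1, 2, one_pos, one_lt_two⟩
  obtain ⟨L, hL⟩ := (b.contDiff.continuous_fderiv (n := ∞)
    (by simp)).bounded_above_of_compact_support (b.hasCompactSupport.fderiv (𝕜 := ℝ))
  refine ⟨L, (norm_nonneg _).trans (hL 0), fun R hR y => ?_⟩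
  calc ‖fderiv ℝ (cutoff R) y‖ = R⁻¹ * ‖fderiv ℝ b (R⁻¹ • y)‖ := by
        rw [show cutoff R = fun y => b (R⁻¹ • y) from rfl, fderiv_comp_smul, norm_smul, norm_inv,
          Real.norm_of_nonneg hR.le]
    _ ≤ L / R := by
        rw [div_eq_inv_mul]
        gcongr
        exact hL _

end Cutoff

section TestClosure

theorem integrable_inner_of_memLp_two {α H : Type*} [MeasurableSpace α] {μ : Measure α}
    [NormedAddCommGroup H] [InnerProductSpace ℂ H] {f g : α → H} (hf : MemLp f 2 μ)
    (hg : MemLp g 2 μ) : Integrable (fun x => ⟪f x, g x⟫_ℂ) μ :=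
  memLp_one_iff_integrable.1 <| hf.of_bilin (fun x y => ⟪x, y⟫_ℂ) 1 hg (hf.1.inner hg.1) <|
    Eventually.of_forall fun x => by
      rw [one_mul]
      exact nnnorm_inner_le_nnnorm _ _

variable {d : ℕ} {Ω Ω' : Set (Eu d)} {u : Eu d → ℂ} {χ : Eu d → ℝ} {J J' F : Eu d → Jet d}

/-- The field of jets `J` is in the `L²(Ω)` closure of the jets of test functions; for the jets of
a function in `H¹(Ω)`, this says that the function is in `H¹₀(Ω)`. -/
def InTestClosure (Ω : Set (Eu d)) (J : Eu d → Jet d) : Prop :=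
  MemLp J 2 (volume.restrict Ω) ∧ ∀ δ : ℝ≥0∞, 0 < δ → ∃ φ : Eu d → ℂ, IsTest Ω φ ∧
    eLpNorm (fun y => J y - classicalJet φ y) 2 (volume.restrict Ω) ≤ δ

/-- The field `F` is orthogonal in `L²(Ω)` to the jets of test functions; this is the weak form of a
homogeneous equation with flux `F`. -/
def AnnihilatesTests (Ω : Set (Eu d)) (F : Eu d → Jet d) : Prop :=
  ∀ φ : Eu d → ℂ, IsTest Ω φ → ∫ y in Ω, ⟪classicalJet φ y, F y⟫_ℂ = 0

theorem IsTest.sub {φ ψ : Eu d → ℂ} (hφ : IsTest Ω φ) (hψ : IsTest Ω ψ) :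
    IsTest Ω (fun y => φ y - ψ y) :=
  ⟨hφ.1.sub hψ.1, hφ.2.1.sub hψ.2.1, (tsupport_sub φ ψ).trans (Set.union_subset hφ.2.2 hψ.2.2)⟩

theorem classicalJet_sub {φ ψ : Eu d → ℂ} {y : Eu d} (hφ : DifferentiableAt ℝ φ y)
    (hψ : DifferentiableAt ℝ ψ y) :
    classicalJet (fun y => φ y - ψ y) y = classicalJet φ y - classicalJet ψ y :=
  Jet.ext rfl fun i => by simp [classicalJet, jet, partialD, fderiv_fun_sub hφ hψ]

theorem InTestClosure.sub (hJ : InTestClosure Ω J) (hJ' : InTestClosure Ω J') :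
    InTestClosure Ω (fun y => J y - J' y) := by
  refine ⟨hJ.1.sub hJ'.1, fun δ hδ => ?_⟩
  obtain ⟨φ, hφ, hle⟩ := hJ.2 (δ / 2) (ENNReal.half_pos hδ.ne')
  obtain ⟨ψ, hψ, hle'⟩ := hJ'.2 (δ / 2) (ENNReal.half_pos hδ.ne')
  refine ⟨_, hφ.sub hψ, ?_⟩
  calc _ = eLpNorm ((fun y => J y - classicalJet φ y) - fun y => J' y - classicalJet ψ y) 2
          (volume.restrict Ω) := by
        congr 1
        ext1 y
        rw [classicalJet_sub (hφ.1.differentiable (by simp) y) (hψ.1.differentiable (by simp) y)]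
        simp only [Pi.sub_apply]
        abel
    _ ≤ δ / 2 + δ / 2 := (eLpNorm_sub_le (hJ.1.sub (hφ.memLp_classicalJet 2 _)).1
        (hJ'.1.sub (hψ.memLp_classicalJet 2 _)).1 one_le_two).trans (add_le_add hle hle')
    _ = δ := ENNReal.add_halves δ

theorem InTestClosure.jetMul {C : ℝ} (h : InTestClosure Ω J) (hχ : ContDiff ℝ ∞ χ)
    (hC : ∀ y, |χ y| + ‖fderiv ℝ χ y‖ ≤ C) (hsupp : tsupport χ ⊆ Ω') (hs : Ω' ⊆ Ω) :
    InTestClosure Ω' (jetMul χ J) := by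
  have hle : volume.restrict Ω' ≤ volume.restrict Ω := Measure.restrict_mono_set _ hs
  refine ⟨memLp_jetMul (h.1.mono_measure hle) hχ hC, fun δ hδ => ?_⟩
  obtain ⟨φ, hφ, hφδ⟩ := h.2 (δ / ENNReal.ofReal C) (ENNReal.div_pos hδ.ne' ENNReal.ofReal_ne_top)
  refine ⟨_, hφ.smul hχ hsupp, ?_⟩
  calc _ = eLpNorm (_root_.jetMul χ fun y => J y - classicalJet φ y) 2 (volume.restrict Ω') := by
        congr 1
        ext1 y
        rw [jetMul_sub, classicalJet_smul (hχ.differentiable (by simp) y)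
          (hφ.1.differentiable (by simp) y)]
    _ ≤ ENNReal.ofReal C * eLpNorm (fun y => J y - classicalJet φ y) 2 (volume.restrict Ω') :=
        eLpNorm_jetMul_le hC _ 2
    _ ≤ ENNReal.ofReal C * (δ / ENNReal.ofReal C) := by
        gcongr
        exact (eLpNorm_mono_measure _ hle).trans hφδ
    _ ≤ δ := ENNReal.mul_div_le

theorem MemH10.inTestClosure (h : MemH10 Ω u) (hΩ : IsOpen Ω) :
    InTestClosure Ω (weakJet Ω u) := by
  obtain ⟨hu, φ, hφ, hlim⟩ := h
  refine ⟨hu.memLp_weakJet, fun δ hδ => ?_⟩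
  have hlim' := ENNReal.tendsto_ofReal hlim
  rw [ENNReal.ofReal_zero] at hlim'
  obtain ⟨n, hn⟩ := ((ENNReal.tendsto_nhds_zero.1 hlim') δ hδ).exists
  have htest : MemH1 Ω (φ n) := MemH1.of_isTest (hφ n) Ω
  refine ⟨φ n, hφ n, le_of_eq_of_le (eLpNorm_congr_ae ?_)
    ((hu.sub htest).eLpNorm_weakJet.trans_le hn)⟩
  filter_upwards [hu.weakJet_sub_ae_eq htest hΩ, (hφ n).weakJet_ae_eq hΩ] with y hsub hclassical
  rw [hsub, hclassical]

theorem IsTest.setIntegral_inner_classicalJet_eq {φ : Eu d → ℂ} (hφ : IsTest Ω φ)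
    (hs : Ω ⊆ Ω') (F : Eu d → Jet d) :
    ∫ y in Ω', ⟪classicalJet φ y, F y⟫_ℂ = ∫ y in Ω, ⟪classicalJet φ y, F y⟫_ℂ := by
  have hoff : ∀ y ∉ Ω, ⟪classicalJet φ y, F y⟫_ℂ = 0 := fun y hy => by
    rw [hφ.classicalJet_eq_zero hy, inner_zero_left]
  rw [setIntegral_eq_integral_of_forall_compl_eq_zero hoff,
    setIntegral_eq_integral_of_forall_compl_eq_zero fun y hy => hoff y fun h => hy (hs h)]

theorem AnnihilatesTests.mono (h : AnnihilatesTests Ω' F) (hs : Ω ⊆ Ω') :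
    AnnihilatesTests Ω F := fun φ hφ =>
  (hφ.setIntegral_inner_classicalJet_eq hs F).symm.trans (h φ (hφ.mono hs))

theorem AnnihilatesTests.integral_inner_eq_zero (h : AnnihilatesTests Ω F)
    (hF : MemLp F 2 (volume.restrict Ω)) (hJ : InTestClosure Ω J) :
    ∫ y in Ω, ⟪J y, F y⟫_ℂ = 0 := by
  have happrox : ∀ δ : ℝ≥0∞, 0 < δ →
      ‖∫ y in Ω, ⟪J y, F y⟫_ℂ‖ₑ ≤ δ * eLpNorm F 2 (volume.restrict Ω) := by
    intro δ hδ
    obtain ⟨φ, hφ, hle⟩ := hJ.2 δ hδ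
    have hφ2 := hφ.memLp_classicalJet 2 (volume.restrict Ω)
    have hsplit : ∫ y in Ω, ⟪J y, F y⟫_ℂ = ∫ y in Ω, ⟪J y - classicalJet φ y, F y⟫_ℂ := by
      simp_rw [inner_sub_left]
      rw [integral_sub (integrable_inner_of_memLp_two hJ.1 hF)
        (integrable_inner_of_memLp_two hφ2 hF), h φ hφ, sub_zero]
    rw [hsplit]
    calc _ ≤ eLpNorm (fun y => ⟪J y - classicalJet φ y, F y⟫_ℂ) 1 (volume.restrict Ω) := by
          rw [eLpNorm_one_eq_lintegral_enorm]
          exact enorm_integral_le_lintegral_enorm _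
      _ ≤ eLpNorm (fun y => J y - classicalJet φ y) 2 (volume.restrict Ω) *
          eLpNorm F 2 (volume.restrict Ω) := by
          refine (eLpNorm_le_eLpNorm_mul_eLpNorm'_of_norm (p := 2) (q := 2) (r := 1)
            (hJ.1.sub hφ2).1 hF.1 (fun x y => ⟪x, y⟫_ℂ) 1
            (Eventually.of_forall fun y => ?_)).trans_eq (by rw [ENNReal.coe_one, one_mul]; rfl)
          rw [NNReal.coe_one, one_mul]
          exact norm_inner_le_norm _ _
      _ ≤ _ := by gcongr
  refine enorm_eq_zero.1 (nonpos_iff_eq_zero.1 (le_of_forall_gt_imp_ge_of_dense fun δ hδ => ?_))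
  refine (happrox _ (ENNReal.div_pos hδ.ne' hF.2.ne)).trans ?_
  rw [mul_comm]
  exact ENNReal.mul_div_le

end TestClosure

section WholeSpace

variable {d : ℕ} {u g : Eu d → ℂ} {i : Fin d} {J : Eu d → Jet d}

theorem contDiff_mollify (ρ : ContDiffBump (0 : Eu d)) (hu : LocallyIntegrable u volume) :
    ContDiff ℝ ∞ (mollify volume ρ u) :=
  ρ.hasCompactSupport_normed.contDiff_convolution_left _ ρ.contDiff_normed hu

theorem partialD_mollify (ρ : ContDiffBump (0 : Eu d)) (hu : LocallyIntegrable u volume)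
    (h : HasWeakPartial Set.univ i u g) :
    partialD i (mollify volume ρ u) = mollify volume ρ g := by
  have hρ : ContDiff ℝ ∞ (ρ.normed volume) := ρ.contDiff_normed
  have hρc : HasCompactSupport (ρ.normed volume) := ρ.hasCompactSupport_normed
  ext x
  have hderiv := hρc.hasFDerivAt_convolution_left (ContinuousLinearMap.lsmul ℝ ℝ)
    (hρ.of_le (by simp)) hu x
  have hconv := (hρc.fderiv (𝕜 := ℝ)).convolutionExists_left
    ((ContinuousLinearMap.lsmul ℝ ℝ : ℝ →L[ℝ] ℂ →L[ℝ] ℂ).precompL (Eu d))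
    (hρ.continuous_fderiv (by simp)) hu x
  have htest : IsTest Set.univ fun y => ρ.normed volume (x - y) :=
    ⟨hρ.comp (by fun_prop), hρc.comp_homeomorph (Homeomorph.subLeft x), Set.subset_univ _⟩
  have hweak : ∫ y, partialD i (ρ.normed volume) (x - y) • u y
      = ∫ y, ρ.normed volume (x - y) • g y := by
    have := h.2 _ htest
    simpa only [partialD_comp_const_sub (hρ.differentiable (by simp) _), setIntegral_univ, neg_smul,
      integral_neg, neg_inj] using this
  rw [partialD, hderiv.fderiv, convolution_def, ContinuousLinearMap.integral_apply hconv,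
    mollify, convolution_eq_swap]
  refine Eq.trans ?_ hweak
  rw [← integral_sub_left_eq_self _ volume x]
  simp [partialD]

theorem MemH1.locallyIntegrable (hu : MemH1 Set.univ u) : LocallyIntegrable u volume :=
  MemLp.locallyIntegrable (by simpa using hu.1) one_le_two

theorem MemH1.memLp_weakJet_univ (hu : MemH1 Set.univ u) :
    MemLp (weakJet Set.univ u) 2 volume := by
  simpa using hu.memLp_weakJet

theorem classicalJet_mollify (ρ : ContDiffBump (0 : Eu d)) (hu : MemH1 Set.univ u) :
    classicalJet (mollify volume ρ u) = mollify volume ρ (weakJet Set.univ u) := by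
  ext1 x
  have hint : Integrable (fun z => ρ.normed volume z • weakJet Set.univ u (x - z)) :=
    ρ.hasCompactSupport_normed.convolutionExists_left (ContinuousLinearMap.lsmul ℝ ℝ)
      ρ.continuous_normed (hu.memLp_weakJet_univ.locallyIntegrable one_le_two) x
  have hsnd := (WithLp.sndL 2 ℝ ℂ (EuclideanSpace ℂ (Fin d))).integrable_comp hint
  have hmol : mollify volume ρ (weakJet Set.univ u) x =
    ∫ z, ρ.normed volume z • weakJet Set.univ u (x - z) := rfl
  rw [hmol]
  refine Jet.ext ?_ fun i => ?_
  · rw [fst_integral_withLp hint]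
    rfl
  · rw [snd_integral_withLp hint, eval_integral_piLp fun i =>
      (EuclideanSpace.proj (𝕜 := ℂ) i).integrable_comp hsnd]
    exact congrFun (partialD_mollify ρ hu.locallyIntegrable (hu.hasWeakPartial i)) x

theorem exists_eLpNorm_jetMul_one_sub_cutoff_le (hJ : MemLp J 2 volume) {δ : ℝ≥0∞} (hδ : 0 < δ) :
    ∃ R : ℝ, 1 ≤ R ∧ eLpNorm (jetMul (1 - cutoff R) J) 2 volume ≤ δ := by
  obtain ⟨L, hL0, hL⟩ := exists_norm_fderiv_cutoff_le (Eu d)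
  obtain ⟨g, hgc, hgδ, -, -⟩ := hJ.exists_hasCompactSupport_eLpNorm_sub_le ENNReal.ofNat_ne_top
    (ENNReal.div_pos hδ.ne' (ENNReal.ofReal_ne_top (r := 1 + L))).ne'
  obtain ⟨R, hR, hsupp⟩ := hgc.isCompact.isBounded.subset_ball_lt 1 0
  refine ⟨R, hR.le, ?_⟩
  have hpt : ∀ y, ‖jetMul (1 - cutoff R) J y‖ ≤ (1 + L) * ‖(J - g) y‖ := by
    intro y
    by_cases hy : ‖y‖ < R
    · have hone : (1 - cutoff R : Eu d → ℝ) =ᶠ[𝓝 y] fun _ => 0 := by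
        filter_upwards [cutoff_eventuallyEq_one (one_pos.trans hR) hy] with z hz
        simp [hz]
      rw [jetMul_apply_of_eventuallyEq hone, zero_smul, norm_zero]
      positivity
    · have hg : g y = 0 := image_eq_zero_of_notMem_tsupport fun h => hy (by simpa using hsupp h)
      rw [Pi.sub_apply, hg, sub_zero]
      refine (norm_jetMul_le _ J y).trans (mul_le_mul_of_nonneg_right ?_ (norm_nonneg _))
      exact abs_one_sub_cutoff_add_norm_fderiv_le
        ((hL R (one_pos.trans hR) y).trans (div_le_self hL0 hR.le))
  calc _ ≤ ENNReal.ofReal (1 + L) * eLpNorm (J - g) 2 volume :=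
        eLpNorm_le_mul_eLpNorm_of_ae_le_mul (Eventually.of_forall hpt) 2
    _ ≤ ENNReal.ofReal (1 + L) * (δ / ENNReal.ofReal (1 + L)) := by gcongr
    _ ≤ δ := ENNReal.mul_div_le

theorem isTest_cutoff_smul {R : ℝ} (hR : 0 < R) {f : Eu d → ℂ} (hf : ContDiff ℝ ∞ f) :
    IsTest Set.univ fun y => cutoff R y • f y := by
  have hc : HasCompactSupport (cutoff R : Eu d → ℝ) :=
    (isCompact_closedBall 0 _).of_isClosed_subset (isClosed_tsupport _) (tsupport_cutoff_subset hR)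
  exact ⟨(contDiff_cutoff R).smul hf, hc.smul_right, Set.subset_univ _⟩

theorem MemH1.inTestClosure_univ (hu : MemH1 Set.univ u) :
    InTestClosure Set.univ (weakJet Set.univ u) := by
  have hJ := hu.memLp_weakJet_univ
  refine ⟨hu.memLp_weakJet, fun δ hδ => ?_⟩
  rw [Measure.restrict_univ]
  obtain ⟨L, hL0, hL⟩ := exists_norm_fderiv_cutoff_le (Eu d)
  obtain ⟨R, hR, htail⟩ := exists_eLpNorm_jetMul_one_sub_cutoff_le hJ (ENNReal.half_pos hδ.ne')
  obtain ⟨ρ, hρ⟩ := exists_eLpNorm_mollify_sub_le (p := 2) (by norm_num) hJ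
    (ENNReal.div_pos (ENNReal.half_pos hδ.ne').ne' (ENNReal.ofReal_ne_top (r := 1 + L)))
  rw [ENNReal.coe_ofNat] at hρ
  have hC : ∀ y : Eu d, |cutoff R y| + ‖fderiv ℝ (cutoff R) y‖ ≤ 1 + L := fun y =>
    abs_cutoff_add_norm_fderiv_le
      ((hL R (one_pos.trans_le hR) y).trans (div_le_self hL0 hR))
  have hsmooth := contDiff_mollify ρ hu.locallyIntegrable
  have hmeas := ((continuous_classicalJet hsmooth).aestronglyMeasurable (μ := volume)).sub hJ.1
  rw [classicalJet_mollify ρ hu] at hmeas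
  refine ⟨_, isTest_cutoff_smul (one_pos.trans_le hR) hsmooth, ?_⟩
  calc _ = eLpNorm (jetMul (1 - cutoff R) (weakJet Set.univ u) - jetMul (cutoff R)
          fun y => mollify volume ρ (weakJet Set.univ u) y - weakJet Set.univ u y) 2 volume := by
        congr 1
        ext1 y
        rw [Pi.sub_apply, jetMul_one_sub, jetMul_sub,
          classicalJet_smul ((contDiff_cutoff R).differentiable (by simp) y)
            (hsmooth.differentiable (by simp) y), classicalJet_mollify ρ hu,
          sub_sub_sub_cancel_right]
    _ ≤ δ / 2 + ENNReal.ofReal (1 + L) * (δ / 2 / ENNReal.ofReal (1 + L)) := by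
        refine (eLpNorm_sub_le
          (aestronglyMeasurable_jetMul hJ.1 (contDiff_const.sub (contDiff_cutoff R)))
          (aestronglyMeasurable_jetMul hmeas (contDiff_cutoff R)) one_le_two).trans ?_
        exact add_le_add htail ((eLpNorm_jetMul_le hC _ 2).trans (by gcongr; exact hρ))
    _ ≤ δ / 2 + δ / 2 := by
        gcongr
        exact ENNReal.mul_div_le
    _ = δ := ENNReal.add_halves δ

end WholeSpace

section Ellipticity

/-- A bounded measurable field of operators with uniformly positive real part: the coefficients of
an elliptic equation for fields with values in `H`, with ellipticity constant `c` and bound `K`. -/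
structure IsUniformlyElliptic {α H : Type*} [MeasurableSpace α] [NormedAddCommGroup H]
    [InnerProductSpace ℂ H] (T : α → H →L[ℂ] H) (c K : ℝ) : Prop where
  stronglyMeasurable : StronglyMeasurable T
  pos : 0 < c
  norm_le : ∀ y, ‖T y‖ ≤ K
  le_re_inner : ∀ y ξ, c * ‖ξ‖ ^ 2 ≤ (⟪ξ, T y ξ⟫_ℂ).re

namespace IsUniformlyElliptic

variable {α H : Type*} [MeasurableSpace α] [NormedAddCommGroup H] [InnerProductSpace ℂ H]
  {T : α → H →L[ℂ] H} {c K : ℝ} {μ : Measure α}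

theorem memLp_apply (hT : IsUniformlyElliptic T c K) {p : ℝ≥0∞} {V : α → H} (hV : MemLp V p μ) :
    MemLp (fun y => T y (V y)) p μ := by
  refine hV.of_le_mul (c := K) ((ContinuousLinearMap.id ℂ (H →L[ℂ] H)).aestronglyMeasurable_comp₂
    hT.stronglyMeasurable.aestronglyMeasurable hV.1) (Eventually.of_forall fun y => ?_)
  exact (T y).le_of_opNorm_le (hT.norm_le y) (V y)

theorem le_re_inner_smul_add (hT : IsUniformlyElliptic T c K) {a : ℝ} (ha : 0 ≤ a) (y : α)
    (ξ η : H) : c * (a * ‖ξ‖ ^ 2) - K * (‖η‖ * ‖ξ‖) ≤ (⟪(a : ℂ) • ξ + η, T y ξ⟫_ℂ).re := by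
  have hη : -(⟪η, T y ξ⟫_ℂ).re ≤ K * (‖η‖ * ‖ξ‖) :=
    calc -(⟪η, T y ξ⟫_ℂ).re ≤ ‖⟪η, T y ξ⟫_ℂ‖ := (neg_le_abs _).trans (Complex.abs_re_le_norm _)
      _ ≤ ‖η‖ * (K * ‖ξ‖) := (norm_inner_le_norm _ _).trans <|
          mul_le_mul_of_nonneg_left ((T y).le_of_opNorm_le (hT.norm_le y) ξ) (norm_nonneg η)
      _ = K * (‖η‖ * ‖ξ‖) := mul_left_comm ..
  have hξ : c * (a * ‖ξ‖ ^ 2) ≤ (⟪(a : ℂ) • ξ, T y ξ⟫_ℂ).re := by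
    rw [inner_smul_left, Complex.conj_ofReal, Complex.re_ofReal_mul, mul_left_comm]
    exact mul_le_mul_of_nonneg_left (hT.le_re_inner y ξ) ha
  rw [inner_add_left, Complex.add_re]
  linarith

/-- Céa's lemma. -/
theorem integral_norm_sq_le (hT : IsUniformlyElliptic T c K) {V P : α → H} (hV : MemLp V 2 μ)
    (hP : MemLp P 2 μ) (horth : ∫ y, ⟪V y + P y, T y (V y)⟫_ℂ ∂μ = 0) :
    ∫ y, ‖V y‖ ^ 2 ∂μ ≤ (K / c) ^ 2 * ∫ y, ‖P y‖ ^ 2 ∂μ := by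
  have hc := hT.pos
  have hV2 : Integrable (fun y => ‖V y‖ ^ 2) μ := hV.integrable_norm_pow two_ne_zero
  have hP2 : Integrable (fun y => ‖P y‖ ^ 2) μ := hP.integrable_norm_pow two_ne_zero
  have hint := integrable_inner_of_memLp_two (hV.add hP) (hT.memLp_apply hV)
  have hpt : ∀ y, c / 2 * ‖V y‖ ^ 2 - K ^ 2 / (2 * c) * ‖P y‖ ^ 2
      ≤ (⟪V y + P y, T y (V y)⟫_ℂ).re := by
    intro y
    have hyoung : c / 2 * ‖V y‖ ^ 2 + K ^ 2 / (2 * c) * ‖P y‖ ^ 2 - K * (‖P y‖ * ‖V y‖)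
        = (c * ‖V y‖ - K * ‖P y‖) ^ 2 / (2 * c) := by
      field_simp
      ring
    have hsq : 0 ≤ (c * ‖V y‖ - K * ‖P y‖) ^ 2 / (2 * c) := by positivity
    have hre := hT.le_re_inner_smul_add zero_le_one y (V y) (P y)
    rw [Complex.ofReal_one, one_smul, one_mul] at hre
    linarith
  have hle : c / 2 * ∫ y, ‖V y‖ ^ 2 ∂μ ≤ K ^ 2 / (2 * c) * ∫ y, ‖P y‖ ^ 2 ∂μ := by
    rw [← sub_nonpos, ← integral_const_mul, ← integral_const_mul,
      ← integral_sub (hV2.const_mul _) (hP2.const_mul _)]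
    refine (integral_mono ((hV2.const_mul _).sub (hP2.const_mul _)) hint.re hpt).trans_eq ?_
    exact (integral_re hint).trans (congrArg Complex.re horth)
  calc ∫ y, ‖V y‖ ^ 2 ∂μ = 2 / c * (c / 2 * ∫ y, ‖V y‖ ^ 2 ∂μ) := by field_simp
    _ ≤ 2 / c * (K ^ 2 / (2 * c) * ∫ y, ‖P y‖ ^ 2 ∂μ) := by gcongr
    _ = (K / c) ^ 2 * ∫ y, ‖P y‖ ^ 2 ∂μ := by field_simp

end IsUniformlyElliptic

end Ellipticity

section TailEnergy

variable {d : ℕ} {Ω Ω' : Set (Eu d)} {χ : Eu d → ℝ} {J : Eu d → Jet d} {R : ℝ}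
  {T : Eu d → Jet d →L[ℂ] Jet d} {c K : ℝ}

theorem IsUniformlyElliptic.le_re_inner_jetMul (hT : IsUniformlyElliptic T c K) {y : Eu d}
    (hχ : 0 ≤ χ y) (J : Eu d → Jet d) :
    c * (χ y * ‖J y‖ ^ 2) - K * (‖fderiv ℝ χ y‖ * ‖J y‖ ^ 2)
      ≤ (⟪jetMul χ J y, T y (J y)⟫_ℂ).re := by
  have hη : ‖jetMul χ J y - χ y • J y‖ * ‖J y‖ ≤ ‖fderiv ℝ χ y‖ * ‖J y‖ ^ 2 := by
    rw [pow_two, ← mul_assoc]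
    exact mul_le_mul_of_nonneg_right (norm_jetMul_sub_smul_le χ J y) (norm_nonneg _)
  have hre := hT.le_re_inner_smul_add hχ y (J y) (jetMul χ J y - χ y • J y)
  rw [Complex.coe_smul, add_sub_cancel] at hre
  linarith [mul_le_mul_of_nonneg_left hη ((norm_nonneg _).trans (hT.norm_le y))]

/-- Caccioppoli's inequality. -/
theorem IsUniformlyElliptic.setIntegral_mul_norm_sq_le (hT : IsUniformlyElliptic T c K)
    (hJ : InTestClosure Ω J) (hTJ : AnnihilatesTests Ω' fun y => T y (J y)) (hs : Ω' ⊆ Ω)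
    (hχ : ContDiff ℝ ∞ χ) (hχ0 : ∀ y, 0 ≤ χ y) {C : ℝ} (hC : ∀ y, |χ y| + ‖fderiv ℝ χ y‖ ≤ C)
    (hsupp : tsupport χ ⊆ Ω') :
    c * ∫ y in Ω', χ y * ‖J y‖ ^ 2 ≤ K * ∫ y in Ω', ‖fderiv ℝ χ y‖ * ‖J y‖ ^ 2 := by
  have hJ' := hJ.1.mono_measure (Measure.restrict_mono_set volume hs)
  have hχJ := hJ.jetMul hχ hC hsupp hs
  have hint := integrable_inner_of_memLp_two hχJ.1 (hT.memLp_apply hJ')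
  have hJ2 : Integrable (fun y => ‖J y‖ ^ 2) (volume.restrict Ω') :=
    hJ'.integrable_norm_pow two_ne_zero
  have hval : Integrable (fun y => χ y * ‖J y‖ ^ 2) (volume.restrict Ω') :=
    hJ2.bdd_mul (c := C) hχ.continuous.aestronglyMeasurable
      (Eventually.of_forall fun y => (le_add_of_nonneg_right (norm_nonneg _)).trans (hC y))
  have hgrad : Integrable (fun y => ‖fderiv ℝ χ y‖ * ‖J y‖ ^ 2) (volume.restrict Ω') :=
    hJ2.bdd_mul (c := C) (hχ.continuous_fderiv (by simp)).norm.aestronglyMeasurable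
      (Eventually.of_forall fun y => (norm_norm _).trans_le
        ((le_add_of_nonneg_left (abs_nonneg _)).trans (hC y)))
  rw [← sub_nonpos, ← integral_const_mul, ← integral_const_mul,
    ← integral_sub (hval.const_mul c) (hgrad.const_mul K)]
  refine (integral_mono ((hval.const_mul c).sub (hgrad.const_mul K)) hint.re
    fun y => hT.le_re_inner_jetMul (hχ0 y) J).trans_eq ?_
  exact (integral_re hint).trans (congrArg Complex.re
    (hTJ.integral_inner_eq_zero (hT.memLp_apply hJ') hχJ))

/-- The `H¹` energy of a field of jets off the open ball of radius `R`. -/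
def tailEnergy (J : Eu d → Jet d) (R : ℝ) : ℝ := ∫ y in (Metric.ball 0 R)ᶜ, ‖J y‖ ^ 2

theorem tailEnergy_nonneg (J : Eu d → Jet d) (R : ℝ) : 0 ≤ tailEnergy J R :=
  integral_nonneg fun _ => by positivity

theorem IsUniformlyElliptic.tailEnergy_two_mul_le (hT : IsUniformlyElliptic T c K)
    (hJ : InTestClosure Set.univ J)
    (hTJ : AnnihilatesTests (Metric.ball 0 R)ᶜ fun y => T y (J y)) (hR : 0 < R) {L : ℝ}
    (hL : ∀ y : Eu d, ‖fderiv ℝ (cutoff R) y‖ ≤ L) :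
    c * tailEnergy J (2 * R) ≤ K * (L * tailEnergy J R) := by
  have hJ2 : Integrable fun y => ‖J y‖ ^ 2 :=
    (by simpa using hJ.1 : MemLp J 2 volume).integrable_norm_pow two_ne_zero
  have hχ : ContDiff ℝ ∞ (1 - cutoff R : Eu d → ℝ) := contDiff_const.sub (contDiff_cutoff R)
  have hχ0 : ∀ y, 0 ≤ (1 - cutoff R : Eu d → ℝ) y := fun y => sub_nonneg.2 (cutoff_le_one R y)
  have hC : ∀ y : Eu d, |(1 - cutoff R : Eu d → ℝ) y| + ‖fderiv ℝ (1 - cutoff R) y‖ ≤ 1 + L :=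
    fun y => abs_one_sub_cutoff_add_norm_fderiv_le (hL y)
  have hχJ : Integrable fun y => (1 - cutoff R : Eu d → ℝ) y * ‖J y‖ ^ 2 :=
    hJ2.bdd_mul (c := 1 + L) hχ.continuous.aestronglyMeasurable
      (Eventually.of_forall fun y => (le_add_of_nonneg_right (norm_nonneg _)).trans (hC y))
  have hlower : tailEnergy J (2 * R) ≤
      ∫ y in (Metric.ball 0 R)ᶜ, (1 - cutoff R : Eu d → ℝ) y * ‖J y‖ ^ 2 := by
    calc tailEnergy J (2 * R)
        = ∫ y in (Metric.ball 0 (2 * R))ᶜ, (1 - cutoff R : Eu d → ℝ) y * ‖J y‖ ^ 2 :=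
          setIntegral_congr_fun Metric.isOpen_ball.measurableSet.compl fun y hy => by
            simp [cutoff_eq_zero hR (by simpa using hy)]
      _ ≤ _ := setIntegral_mono_set hχJ.integrableOn
          (Eventually.of_forall fun y => mul_nonneg (hχ0 y) (by positivity))
          (Set.compl_subset_compl.2 (Metric.ball_subset_ball (by linarith))).eventuallyLE
  have hupper : ∫ y in (Metric.ball 0 R)ᶜ, ‖fderiv ℝ (1 - cutoff R : Eu d → ℝ) y‖ * ‖J y‖ ^ 2
      ≤ L * tailEnergy J R := by
    rw [tailEnergy, ← integral_const_mul]
    refine integral_mono_of_nonneg (Eventually.of_forall fun y => by positivity)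
      (hJ2.integrableOn.const_mul L) (Eventually.of_forall fun y => ?_)
    exact mul_le_mul_of_nonneg_right ((norm_fderiv_one_sub_cutoff R y).trans_le (hL y))
      (by positivity)
  calc _ ≤ _ := mul_le_mul_of_nonneg_left hlower hT.pos.le
    _ ≤ _ := hT.setIntegral_mul_norm_sq_le hJ hTJ (Set.subset_univ _) hχ hχ0 hC
        (tsupport_one_sub_cutoff_subset hR)
    _ ≤ _ := mul_le_mul_of_nonneg_left hupper ((norm_nonneg _).trans (hT.norm_le 0))

end TailEnergy

section RapidDecay

variable {d : ℕ} {J : Eu d → Jet d} {T : Eu d → Jet d →L[ℂ] Jet d} {c K r : ℝ}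

theorem superpolynomialDecay_of_isBigO_comp_two_mul {E : ℝ → ℝ}
    (hbdd : E =O[atTop] fun _ => (1 : ℝ))
    (hE : (fun R => E (2 * R)) =O[atTop] fun R => R⁻¹ * E R) :
    SuperpolynomialDecay atTop id E := by
  have hhalf : Tendsto (fun R : ℝ => R / 2) atTop atTop := tendsto_id.atTop_div_const two_pos
  have hpow : ∀ n : ℕ, E =O[atTop] fun R : ℝ => R⁻¹ ^ n := by
    intro n
    induction n with
    | zero => simpa using hbdd
    | succ n ih =>
      have hstep : (fun R => E (2 * R)) =O[atTop] fun R : ℝ => R⁻¹ ^ (n + 1) := by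
        simpa only [pow_succ'] using hE.trans ((isBigO_refl _ _).mul ih)
      have hscale : (fun R : ℝ => (R / 2)⁻¹ ^ (n + 1)) =O[atTop] fun R => R⁻¹ ^ (n + 1) := by
        simpa only [mul_inv, inv_inv, div_eq_mul_inv, mul_pow, mul_comm] using
          (isBigO_refl (fun R : ℝ => R⁻¹ ^ (n + 1)) atTop).const_mul_left (2 ^ (n + 1))
      simpa only [Function.comp_def, mul_div_cancel₀ _ (two_ne_zero' ℝ)] using
        (hstep.comp_tendsto hhalf).trans hscale
  refine (superpolynomialDecay_iff_isBigO E tendsto_id).2 fun z => ?_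
  refine (hpow z.natAbs).trans (IsBigO.of_bound 1 ?_)
  filter_upwards [eventually_ge_atTop 1] with R hR
  rw [one_mul, inv_pow, ← zpow_natCast, ← zpow_neg, id]
  exact Real.norm_of_nonneg (zpow_nonneg (zero_le_one.trans hR) _) |>.trans_le
    ((zpow_le_zpow_right₀ hR (by omega)).trans (le_abs_self _))

theorem isLittleO_rpow_of_superpolynomialDecay {G : ℝ → ℝ}
    (hG : SuperpolynomialDecay atTop id G) {ρ : ℝ} (hρ : 0 < ρ) (s : ℝ) :
    (fun ε => G (ρ * ε⁻¹)) =o[𝓝[>] 0] fun ε : ℝ => ε ^ s := by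
  have hlim : Tendsto (fun ε : ℝ => ρ * ε⁻¹) (𝓝[>] 0) atTop :=
    tendsto_inv_nhdsGT_zero.const_mul_atTop hρ
  refine (((superpolynomialDecay_iff_isLittleO G tendsto_id).1 hG (-⌈s⌉)).comp_tendsto
    hlim).trans_isBigO (IsBigO.of_bound (ρ ^ (-⌈s⌉)) ?_)
  filter_upwards [Ioo_mem_nhdsGT one_pos] with ε hε
  have hpos := hε.1
  rw [Function.comp_apply, id, mul_zpow, inv_zpow', neg_neg, norm_mul,
    Real.norm_of_nonneg (zpow_nonneg hρ.le _), Real.norm_of_nonneg (zpow_nonneg hpos.le _),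
    Real.norm_of_nonneg (Real.rpow_nonneg hpos.le _), ← Real.rpow_intCast ε]
  refine mul_le_mul_of_nonneg_left ?_ (zpow_nonneg hρ.le _)
  exact Real.rpow_le_rpow_of_exponent_ge hpos hε.2.le (Int.le_ceil s)

theorem tailEnergy_le_integral (hJ : MemLp J 2 volume) (R : ℝ) :
    tailEnergy J R ≤ ∫ y, ‖J y‖ ^ 2 :=
  setIntegral_le_integral (hJ.integrable_norm_pow two_ne_zero)
    (Eventually.of_forall fun _ => by positivity)

theorem IsUniformlyElliptic.superpolynomialDecay_tailEnergy (hT : IsUniformlyElliptic T c K)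
    (hJ : InTestClosure Set.univ J)
    (hTJ : AnnihilatesTests (Metric.closedBall 0 r)ᶜ fun y => T y (J y)) :
    SuperpolynomialDecay atTop id (tailEnergy J) := by
  obtain ⟨L, -, hL⟩ := exists_norm_fderiv_cutoff_le (Eu d)
  have hJ2 : MemLp J 2 volume := by simpa using hJ.1
  refine superpolynomialDecay_of_isBigO_comp_two_mul
    (IsBigO.of_bound (∫ y, ‖J y‖ ^ 2) (Eventually.of_forall fun R => ?_))
    (IsBigO.of_bound (K * L / c) ?_)
  · rw [Real.norm_of_nonneg (tailEnergy_nonneg J R), norm_one, mul_one]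
    exact tailEnergy_le_integral hJ2 R
  filter_upwards [eventually_gt_atTop 0, eventually_gt_atTop r] with R hR hrR
  have hdouble := hT.tailEnergy_two_mul_le hJ (hTJ.mono (Set.compl_subset_compl.2
    (Metric.closedBall_subset_ball hrR))) hR (hL R hR)
  rw [Real.norm_of_nonneg (tailEnergy_nonneg J _), Real.norm_of_nonneg
    (mul_nonneg (inv_nonneg.2 hR.le) (tailEnergy_nonneg J R)), div_mul_eq_mul_div,
    le_div_iff₀' hT.pos]
  exact hdouble.trans_eq (by ring)

end RapidDecay

section CorrectorOperator

variable {d : ℕ} {A A₁ : Matrix (Fin d) (Fin d) ℝ} {B : Set (Eu d)} {m : ℝ}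

theorem exists_pos_forall_mul_norm_sq_le_re_inner {H : Type*} [NormedAddCommGroup H]
    [InnerProductSpace ℂ H] [FiniteDimensional ℂ H] {S : H →L[ℂ] H}
    (hS : ∀ ξ, ξ ≠ 0 → 0 < (⟪ξ, S ξ⟫_ℂ).re) :
    ∃ c : ℝ, 0 < c ∧ ∀ ξ, c * ‖ξ‖ ^ 2 ≤ (⟪ξ, S ξ⟫_ℂ).re := by
  have : ProperSpace H := FiniteDimensional.proper ℂ H
  obtain ⟨c, hc, hle⟩ := (isCompact_sphere (0 : H) 1).exists_forall_le'
    (f := fun ξ => (⟪ξ, S ξ⟫_ℂ).re) (by fun_prop)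
    fun ξ hξ => hS ξ (ne_zero_of_mem_unit_sphere ⟨ξ, hξ⟩)
  refine ⟨c, hc, fun ξ => ?_⟩
  rcases eq_or_ne ξ 0 with rfl | hξ
  · simp
  have hpos : 0 < ‖ξ‖ := norm_pos_iff.2 hξ
  have hunit := hle ((‖ξ‖⁻¹ : ℂ) • ξ) (by simp [norm_smul, hpos.ne'])
  rw [map_smul, inner_smul_left, inner_smul_right, map_inv₀, Complex.conj_ofReal, ← mul_assoc,
    ← Complex.ofReal_inv, ← Complex.ofReal_mul, Complex.re_ofReal_mul, ← mul_inv, ← pow_two,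
    le_inv_mul_iff₀ (pow_pos hpos 2), mul_comm] at hunit
  exact hunit

/-- The action on `ℂᵈ` of a real matrix. -/
def complexification (A : Matrix (Fin d) (Fin d) ℝ) :
    EuclideanSpace ℂ (Fin d) →L[ℂ] EuclideanSpace ℂ (Fin d) :=
  Matrix.toEuclideanCLM (n := Fin d) (𝕜 := ℂ) (A.map Complex.ofReal)

theorem inner_complexification (A : Matrix (Fin d) (Fin d) ℝ) (ξ η : EuclideanSpace ℂ (Fin d)) :
    ⟪ξ, complexification A η⟫_ℂ = ∑ i, ∑ j, conj (ξ i) * (A i j : ℂ) * η j := by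
  simp only [complexification, PiLp.inner_apply, Matrix.ofLp_toEuclideanCLM, Matrix.mulVec,
    dotProduct, Matrix.map_apply, RCLike.inner_apply, Finset.sum_mul]
  exact Finset.sum_congr rfl fun i _ => Finset.sum_congr rfl fun j _ => by ring

theorem re_inner_complexification_self (A : Matrix (Fin d) (Fin d) ℝ)
    (ξ : EuclideanSpace ℂ (Fin d)) :
    (⟪ξ, complexification A ξ⟫_ℂ).re = (fun i => (ξ i).re) ⬝ᵥ A.mulVec (fun i => (ξ i).re) +
      (fun i => (ξ i).im) ⬝ᵥ A.mulVec (fun i => (ξ i).im) := by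
  rw [inner_complexification]
  simp only [Complex.re_sum, Complex.mul_re, Complex.conj_re, Complex.ofReal_re, Complex.conj_im,
    Complex.ofReal_im, mul_zero, sub_zero, Complex.mul_im, neg_mul, zero_add, sub_neg_eq_add,
    dotProduct, Matrix.mulVec, Finset.mul_sum, ← Finset.sum_add_distrib]
  refine Finset.sum_congr rfl fun i _ => Finset.sum_congr rfl fun j _ => ?_
  ring

theorem re_inner_complexification_self_pos (hA : A.PosDef) {ξ : EuclideanSpace ℂ (Fin d)}
    (hξ : ξ ≠ 0) : 0 < (⟪ξ, complexification A ξ⟫_ℂ).re := by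
  rw [re_inner_complexification_self]
  have hnonneg : ∀ x : Fin d → ℝ, 0 ≤ x ⬝ᵥ A.mulVec x := fun x => by
    simpa using hA.posSemidef.dotProduct_mulVec_nonneg x
  have hpos : ∀ x : Fin d → ℝ, x ≠ 0 → 0 < x ⬝ᵥ A.mulVec x := fun x hx => by
    simpa using hA.dotProduct_mulVec_pos hx
  by_cases hre : (fun i => (ξ i).re) = 0
  · refine add_pos_of_nonneg_of_pos (hnonneg _) (hpos _ fun him => hξ (PiLp.ext fun i => ?_))
    exact Complex.ext (congrFun hre i) (congrFun him i)
  · exact add_pos_of_pos_of_nonneg (hpos _ hre) (hnonneg _)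

theorem Amin_pos [NeZero d] (hA : A.PosDef) : 0 < Amin A := by
  obtain ⟨c, hc, hle⟩ := exists_pos_forall_mul_norm_sq_le_re_inner fun ξ hξ =>
    re_inner_complexification_self_pos hA hξ
  have : Nonempty (Metric.sphere (0 : EuclideanSpace ℂ (Fin d)) 1) :=
    (NormedSpace.sphere_nonempty.2 zero_le_one).to_subtype
  refine hc.trans_le (le_ciInf fun ξ => ?_)
  have hcξ := hle ξ.1
  rwa [norm_eq_of_mem_sphere ξ, one_pow, mul_one, inner_complexification] at hcξ

/-- The operator `(a, ξ) ↦ (m a, A ξ)` on jets, which gives the flux of `m - div A ∇`. -/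
def jetOperator (m : ℝ) (A : Matrix (Fin d) (Fin d) ℝ) : Jet d →L[ℂ] Jet d :=
  (WithLp.prodContinuousLinearEquiv 2 ℂ ℂ (EuclideanSpace ℂ (Fin d))).symm.toContinuousLinearMap ∘L
    (((m : ℂ) • ContinuousLinearMap.id ℂ ℂ).prodMap (complexification A)) ∘L
    (WithLp.prodContinuousLinearEquiv 2 ℂ ℂ (EuclideanSpace ℂ (Fin d))).toContinuousLinearMap

theorem inner_jetOperator (m : ℝ) (A : Matrix (Fin d) (Fin d) ℝ) (J J' : Jet d) :
    ⟪J, jetOperator m A J'⟫_ℂ = m * J'.fst * conj J.fst + ⟪J.snd, complexification A J'.snd⟫_ℂ := by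
  simp [jetOperator, WithLp.prod_inner_apply]

theorem re_inner_jetOperator_self_pos (hm : 0 < m) (hA : A.PosDef) {J : Jet d} (hJ : J ≠ 0) :
    0 < (⟪J, jetOperator m A J⟫_ℂ).re := by
  have hfst : (m * J.fst * conj J.fst).re = m * ‖J.fst‖ ^ 2 := by
    rw [mul_assoc, Complex.mul_conj, Complex.re_ofReal_mul, Complex.ofReal_re,
      Complex.normSq_eq_norm_sq]
  rw [inner_jetOperator, Complex.add_re, hfst]
  rcases eq_or_ne J.snd 0 with hsnd | hsnd
  · have hJ1 : J.fst ≠ 0 := fun h => hJ (Jet.ext h fun i => by rw [hsnd]; rfl)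
    rw [hsnd, inner_zero_left, Complex.zero_re, add_zero]
    positivity
  · exact add_pos_of_nonneg_of_pos (by positivity) (re_inner_complexification_self_pos hA hsnd)

/-- The field of operators `Ã ⊕ A_min` that defines the corrector equation. -/
def correctorOperator (A A₁ : Matrix (Fin d) (Fin d) ℝ) (B : Set (Eu d)) (y : Eu d) :
    Jet d →L[ℂ] Jet d :=
  jetOperator (Amin A) (coeff A A₁ B y)

theorem correctorForm_eq_setIntegral_inner (A A₁ : Matrix (Fin d) (Fin d) ℝ) (B Ω : Set (Eu d))
    (u φ : Eu d → ℂ) :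
    correctorForm A A₁ B Ω u φ =
      ∫ y in Ω, ⟪classicalJet φ y, correctorOperator A A₁ B y (weakJet Ω u y)⟫_ℂ := by
  refine integral_congr_ae (Eventually.of_forall fun y => ?_)
  simp only [correctorOperator, inner_jetOperator, inner_complexification]
  rw [add_comm]
  congr 1
  refine Finset.sum_congr rfl fun i _ => Finset.sum_congr rfl fun j _ => ?_
  exact mul_right_comm _ _ _ |>.trans (congrArg (· * _) (mul_comm _ _))

theorem exists_isUniformlyElliptic_correctorOperator [NeZero d] (hA : A.PosDef) (hA₁ : A₁.PosDef)
    (hB : MeasurableSet B) :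
    ∃ c K : ℝ, IsUniformlyElliptic (correctorOperator A A₁ B) c K := by
  classical
  have hcoe : correctorOperator A A₁ B =
      fun y => if y ∈ B then jetOperator (Amin A) A₁ else jetOperator (Amin A) A := by
    ext1 y
    rw [correctorOperator, coeff]
    split_ifs <;> rfl
  obtain ⟨c, hc, hle⟩ := exists_pos_forall_mul_norm_sq_le_re_inner fun J hJ =>
    re_inner_jetOperator_self_pos (Amin_pos hA) hA hJ
  obtain ⟨c₁, hc₁, hle₁⟩ := exists_pos_forall_mul_norm_sq_le_re_inner fun J hJ =>
    re_inner_jetOperator_self_pos (Amin_pos hA) hA₁ hJ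
  refine ⟨min c c₁, max ‖jetOperator (Amin A) A‖ ‖jetOperator (Amin A) A₁‖, ?_, lt_min hc hc₁,
    fun y => ?_, fun y ξ => ?_⟩
  · rw [hcoe]
    exact StronglyMeasurable.ite hB stronglyMeasurable_const stronglyMeasurable_const
  · rw [hcoe]
    dsimp only
    split_ifs
    exacts [le_max_right _ _, le_max_left _ _]
  · rw [hcoe]
    dsimp only
    split_ifs
    · exact (mul_le_mul_of_nonneg_right (min_le_right _ _) (by positivity)).trans (hle₁ ξ)
    · exact (mul_le_mul_of_nonneg_right (min_le_left _ _) (by positivity)).trans (hle ξ)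

end CorrectorOperator

section Comparison

variable {d : ℕ} {D Ω : Set (Eu d)} {J U : Eu d → Jet d} {T : Eu d → Jet d →L[ℂ] Jet d}
  {u v : Eu d → ℂ} {c K L R r : ℝ}

theorem setIntegral_norm_sq_jetMul_one_sub_cutoff_le (hJ : MemLp J 2 volume) (hR : 0 < R)
    (hL : ∀ y : Eu d, ‖fderiv ℝ (cutoff R) y‖ ≤ L) (Ω : Set (Eu d)) :
    ∫ y in Ω, ‖jetMul (1 - cutoff R) J y‖ ^ 2 ≤ (1 + L) ^ 2 * tailEnergy J R := by
  have hC : ∀ y : Eu d, |(1 - cutoff R : Eu d → ℝ) y| + ‖fderiv ℝ (1 - cutoff R) y‖ ≤ 1 + L :=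
    fun y => abs_one_sub_cutoff_add_norm_fderiv_le (hL y)
  have hint : Integrable (fun y => ‖jetMul (1 - cutoff R) J y‖ ^ 2) :=
    (memLp_jetMul hJ (contDiff_const.sub (contDiff_cutoff R)) hC).integrable_norm_pow two_ne_zero
  have hzero : ∀ y ∉ (Metric.ball (0 : Eu d) R)ᶜ, ‖jetMul (1 - cutoff R) J y‖ ^ 2 = 0 := by
    intro y hy
    have hconst : (1 - cutoff R : Eu d → ℝ) =ᶠ[𝓝 y] fun _ => 0 := by
      filter_upwards [cutoff_eventuallyEq_one hR
        (mem_ball_zero_iff.1 (Set.notMem_compl_iff.1 hy))] with z hz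
      simp [hz]
    rw [jetMul_apply_of_eventuallyEq hconst, zero_smul, norm_zero, zero_pow two_ne_zero]
  calc ∫ y in Ω, ‖jetMul (1 - cutoff R) J y‖ ^ 2
      ≤ ∫ y, ‖jetMul (1 - cutoff R) J y‖ ^ 2 :=
        setIntegral_le_integral hint (Eventually.of_forall fun y => by positivity)
    _ = ∫ y in (Metric.ball 0 R)ᶜ, ‖jetMul (1 - cutoff R) J y‖ ^ 2 :=
        (setIntegral_eq_integral_of_forall_compl_eq_zero hzero).symm
    _ ≤ ∫ y in (Metric.ball 0 R)ᶜ, (1 + L) ^ 2 * ‖J y‖ ^ 2 := by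
        refine integral_mono hint.integrableOn
          ((hJ.integrable_norm_pow two_ne_zero).integrableOn.const_mul _) fun y => ?_
        rw [← mul_pow]
        exact pow_le_pow_left₀ (norm_nonneg _)
          ((norm_jetMul_le _ J y).trans (mul_le_mul_of_nonneg_right (hC y) (norm_nonneg _))) 2
    _ = (1 + L) ^ 2 * tailEnergy J R := integral_const_mul ..

theorem IsUniformlyElliptic.setIntegral_norm_sub_sq_le (hT : IsUniformlyElliptic T c K)
    (hU : InTestClosure Ω U) (hJ : InTestClosure Set.univ J)
    (hUJ : AnnihilatesTests Ω fun y => T y (U y - J y)) (hR : 0 < R)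
    (hball : Metric.closedBall 0 (2 * R) ⊆ Ω)
    (hL : ∀ y : Eu d, ‖fderiv ℝ (cutoff R) y‖ ≤ L) :
    ∫ y in Ω, ‖U y - J y‖ ^ 2 ≤ (K / c) ^ 2 * ((1 + L) ^ 2 * tailEnergy J R) := by
  have hJ2 : MemLp J 2 volume := by simpa using hJ.1
  have hV : MemLp (fun y => U y - J y) 2 (volume.restrict Ω) := hU.1.sub (hJ2.restrict Ω)
  have hP : MemLp (jetMul (1 - cutoff R) J) 2 (volume.restrict Ω) :=
    memLp_jetMul (hJ2.restrict Ω) (contDiff_const.sub (contDiff_cutoff R))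
      fun y => abs_one_sub_cutoff_add_norm_fderiv_le (hL y)
  have hVP : InTestClosure Ω fun y => U y - J y + jetMul (1 - cutoff R) J y := by
    have hsplit : (fun y => U y - J y + jetMul (1 - cutoff R) J y) =
        fun y => U y - jetMul (cutoff R) J y := by
      rw [jetMul_one_sub]
      exact funext fun y => sub_add_sub_cancel ..
    rw [hsplit]
    exact hU.sub (hJ.jetMul (contDiff_cutoff R) (fun y => abs_cutoff_add_norm_fderiv_le (hL y))
      ((tsupport_cutoff_subset hR).trans hball) (Set.subset_univ Ω))
  calc ∫ y in Ω, ‖U y - J y‖ ^ 2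
      ≤ (K / c) ^ 2 * ∫ y in Ω, ‖jetMul (1 - cutoff R) J y‖ ^ 2 :=
        hT.integral_norm_sq_le hV hP (hUJ.integral_inner_eq_zero (hT.memLp_apply hV) hVP)
    _ ≤ (K / c) ^ 2 * ((1 + L) ^ 2 * tailEnergy J R) :=
        mul_le_mul_of_nonneg_left (setIntegral_norm_sq_jetMul_one_sub_cutoff_le hJ2 hR hL Ω)
          (sq_nonneg _)

theorem MemH1.h1Norm_comp_smul_le (hc : 1 ≤ c) (hΩ : IsOpen Ω) (h : MemH1 (c • Ω) u) :
    h1Norm Ω (fun x => u (c • x)) ≤ c * h1Norm (c • Ω) u := by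
  have hc0 : 0 < c := one_pos.trans_le hc
  have hjet : (fun x => ‖weakJet Ω (fun x => u (c • x)) x‖ ^ 2) ≤ᵐ[volume.restrict Ω]
      fun x => c ^ 2 * ‖weakJet (c • Ω) u (c • x)‖ ^ 2 := by
    filter_upwards [weakJet_ae_eq hΩ fun i => (h.hasWeakPartial i).comp_smul hc0] with x hx
    rw [hx]
    simp only [weakJet, norm_sq_jet, norm_smul, mul_pow, ← Finset.mul_sum, Real.norm_eq_abs,
      sq_abs, mul_add]
    exact add_le_add_left (le_mul_of_one_le_left (sq_nonneg _) (one_le_pow₀ hc)) _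
  have hscale := Measure.setIntegral_comp_smul_of_pos volume
    (fun y => ‖weakJet (c • Ω) u y‖ ^ 2) Ω hc0
  have hint : IntegrableOn (fun x => ‖weakJet (c • Ω) u (c • x)‖ ^ 2) Ω :=
    (memLp_jet_iff.2 ⟨memLp_comp_const_smul hc0 h.1, fun i =>
      memLp_comp_const_smul hc0 (h.hasWeakPartial i).1⟩).integrable_norm_pow two_ne_zero
  refine (pow_le_pow_iff_left₀ (Real.sqrt_nonneg _)
    (mul_nonneg hc0.le (Real.sqrt_nonneg _)) two_ne_zero).1 ?_
  calc h1Norm Ω (fun x => u (c • x)) ^ 2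
      ≤ c ^ 2 * ∫ x in Ω, ‖weakJet (c • Ω) u (c • x)‖ ^ 2 := by
        rw [(h.comp_smul hc0).sq_h1Norm, ← integral_const_mul]
        exact integral_mono_ae ((h.comp_smul hc0).memLp_weakJet.integrable_norm_pow two_ne_zero)
          (hint.const_mul _) hjet
    _ ≤ c ^ 2 * ∫ y in c • Ω, ‖weakJet (c • Ω) u y‖ ^ 2 := by
        rw [hscale, smul_eq_mul]
        gcongr
        exact mul_le_of_le_one_left (integral_nonneg fun _ => by positivity)
          (inv_le_one_of_one_le₀ (one_le_pow₀ hc))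
    _ = (c * h1Norm (c • Ω) u) ^ 2 := by rw [mul_pow, h.sq_h1Norm]

theorem IsUniformlyElliptic.exists_h1Norm_comp_smul_sub_sq_le (hT : IsUniformlyElliptic T c K)
    (hD : IsOpen D) (h0 : 0 ∈ D) (hv : MemH1 Set.univ v) :
    ∃ ρ C : ℝ, 0 < ρ ∧ ∀ a : ℝ, 1 ≤ a → ρ⁻¹ ≤ a → ∀ u : Eu d → ℂ, MemH10 (a • D) u →
      (AnnihilatesTests (a • D) fun y => T y (weakJet (a • D) u y - weakJet Set.univ v y)) →
      h1Norm D (fun x => u (a • x) - v (a • x)) ^ 2 ≤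
        C * (a ^ 2 * tailEnergy (weakJet Set.univ v) (ρ * a)) := by
  obtain ⟨ρ, hρ, hball⟩ := Metric.nhds_basis_closedBall.mem_iff.1 (hD.mem_nhds h0)
  obtain ⟨L, hL0, hL⟩ := exists_norm_fderiv_cutoff_le (Eu d)
  refine ⟨ρ / 2, (K / c) ^ 2 * (1 + L) ^ 2, half_pos hρ, fun a ha hρa u hu huv => ?_⟩
  have ha0 : 0 < a := one_pos.trans_le ha
  have hΩ : IsOpen (a • D) := hD.smul₀ ha0.ne'
  have hR : 1 ≤ ρ / 2 * a := (inv_le_iff_one_le_mul₀' (half_pos hρ)).1 hρa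
  have hball' : Metric.closedBall 0 (2 * (ρ / 2 * a)) ⊆ a • D := by
    have hsmul := Set.smul_set_mono (a := a) hball
    rwa [smul_closedBall _ _ hρ.le, smul_zero, Real.norm_of_nonneg ha0.le,
      show a * ρ = 2 * (ρ / 2 * a) by ring] at hsmul
  have hv' := hv.mono (Set.subset_univ (a • D))
  have hjet : weakJet (a • D) (fun y => u y - v y) =ᵐ[volume.restrict (a • D)]
      fun y => weakJet (a • D) u y - weakJet Set.univ v y := by
    filter_upwards [hu.1.weakJet_sub_ae_eq hv' hΩ,
      hv.weakJet_mono_ae_eq hΩ (Set.subset_univ _)] with y hsub hmono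
    rw [hsub, hmono]
  calc h1Norm D (fun x => u (a • x) - v (a • x)) ^ 2
      ≤ (a * h1Norm (a • D) fun y => u y - v y) ^ 2 :=
        pow_le_pow_left₀ (Real.sqrt_nonneg _) ((hu.1.sub hv').h1Norm_comp_smul_le ha hD) 2
    _ = a ^ 2 * ∫ y in a • D, ‖weakJet (a • D) u y - weakJet Set.univ v y‖ ^ 2 := by
        rw [mul_pow, (hu.1.sub hv').sq_h1Norm]
        congr 1
        exact integral_congr_ae (hjet.fun_comp fun J => ‖J‖ ^ 2)
    _ ≤ a ^ 2 * ((K / c) ^ 2 * ((1 + L) ^ 2 *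
          tailEnergy (weakJet Set.univ v) (ρ / 2 * a))) := by
        gcongr
        exact hT.setIntegral_norm_sub_sq_le (hu.inTestClosure hΩ) hv.inTestClosure_univ huv
          (one_pos.trans_le hR) hball'
          fun y => (hL _ (one_pos.trans_le hR) y).trans (div_le_self hL0 hR)
    _ = _ := by ring

theorem IsUniformlyElliptic.isLittleO_h1Norm_comp_smul_sub (hT : IsUniformlyElliptic T c K)
    (hD : IsOpen D) (h0 : 0 ∈ D) {u : ℝ → Eu d → ℂ}
    (hu : ∀ᶠ ε in 𝓝[>] (0 : ℝ), MemH10 (ε⁻¹ • D) (u ε))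
    (hv : MemH1 Set.univ v)
    (huv : ∀ᶠ ε in 𝓝[>] (0 : ℝ), AnnihilatesTests (ε⁻¹ • D)
      fun y => T y (weakJet (ε⁻¹ • D) (u ε) y - weakJet Set.univ v y))
    (hTv : AnnihilatesTests (Metric.closedBall 0 r)ᶜ fun y => T y (weakJet Set.univ v y)) (s : ℝ) :
    (fun ε : ℝ => h1Norm D fun x => u ε (ε⁻¹ • x) - v (ε⁻¹ • x)) =o[𝓝[>] 0]
      fun ε : ℝ => ε ^ s := by
  obtain ⟨ρ, C, hρ, hbound⟩ := hT.exists_h1Norm_comp_smul_sub_sq_le hD h0 hv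
  have hdecay := isLittleO_rpow_of_superpolynomialDecay
    ((hT.superpolynomialDecay_tailEnergy hv.inTestClosure_univ hTv).param_pow_mul 2) hρ (s * 2)
  have hbig : (fun ε : ℝ => h1Norm D (fun x => u ε (ε⁻¹ • x) - v (ε⁻¹ • x)) ^ 2) =O[𝓝[>] 0]
      fun ε => ((id : ℝ → ℝ) ^ 2 * tailEnergy (weakJet Set.univ v) : ℝ → ℝ) (ρ * ε⁻¹) := by
    refine IsBigO.of_bound (C / ρ ^ 2) ?_
    filter_upwards [hu, huv, tendsto_inv_nhdsGT_zero.eventually_ge_atTop 1,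
      tendsto_inv_nhdsGT_zero.eventually_ge_atTop ρ⁻¹] with ε hu huv hε hρε
    rw [Pi.mul_apply, Pi.pow_apply, id, Real.norm_of_nonneg (sq_nonneg _),
      Real.norm_of_nonneg (mul_nonneg (sq_nonneg _) (tailEnergy_nonneg _ _)), mul_pow]
    refine (hbound ε⁻¹ hε hρε (u ε) hu huv).trans_eq ?_
    field_simp
  have hpow : (fun ε : ℝ => ε ^ (s * 2)) =ᶠ[𝓝[>] 0] (fun ε : ℝ => ε ^ s) ^ 2 := by
    filter_upwards [self_mem_nhdsWithin] with ε hε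
    rw [Real.rpow_mul (le_of_lt hε), Real.rpow_ofNat, Pi.pow_apply]
  exact ((hbig.trans_isLittleO hdecay).trans_eventuallyEq hpow).of_pow two_ne_zero

end Comparison

section Correctors

variable {d : ℕ} {D B Ω : Set (Eu d)} {A A₁ : Matrix (Fin d) (Fin d) ℝ} {u v : Eu d → ℂ}
  {ℓ : (Eu d → ℂ) → ℂ} {r : ℝ}

theorem boundaryTerm_eq_zero (A A₁ : Matrix (Fin d) (Fin d) ℝ) (p : Fin d → ℂ) {φ : Eu d → ℂ}
    (hB : B ⊆ Metric.closedBall 0 r) (hφ : IsTest (Metric.closedBall 0 r)ᶜ φ) :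
    boundaryTerm A A₁ B p φ = 0 :=
  setIntegral_eq_zero_of_forall_eq_zero fun y hy => by
    have hyr : y ∈ Metric.closedBall 0 r :=
      closure_minimal hB Metric.isClosed_closedBall (frontier_subset_closure hy)
    rw [hφ.eq_zero (Set.notMem_compl_iff.2 hyr), map_zero, mul_zero]

theorem annihilatesTests_of_correctorForm_eq (hℓ : ∀ φ, IsTest Ω φ → ℓ φ = 0)
    (hv : ∀ φ, IsTest Set.univ φ → correctorForm A A₁ B Set.univ v φ = ℓ φ) :
    AnnihilatesTests Ω fun y => correctorOperator A A₁ B y (weakJet Set.univ v y) :=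
  fun φ hφ => by
    rw [← hφ.setIntegral_inner_classicalJet_eq (Set.subset_univ Ω),
      ← correctorForm_eq_setIntegral_inner, hv φ (hφ.mono (Set.subset_univ Ω)), hℓ φ hφ]

theorem annihilatesTests_sub_of_correctorForm_eq {c K : ℝ}
    (hT : IsUniformlyElliptic (correctorOperator A A₁ B) c K) (hu : MemH1 Ω u)
    (hv : MemH1 Set.univ v) (huℓ : ∀ φ, IsTest Ω φ → correctorForm A A₁ B Ω u φ = ℓ φ)
    (hvℓ : ∀ φ, IsTest Set.univ φ → correctorForm A A₁ B Set.univ v φ = ℓ φ) :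
    AnnihilatesTests Ω fun y =>
      correctorOperator A A₁ B y (weakJet Ω u y - weakJet Set.univ v y) := by
  intro φ hφ
  have hφ2 := hφ.memLp_classicalJet 2 (volume.restrict Ω)
  have hv2 : MemLp (weakJet Set.univ v) 2 (volume.restrict Ω) :=
    hv.memLp_weakJet.mono_measure (Measure.restrict_mono_set _ (Set.subset_univ Ω))
  simp only [map_sub, inner_sub_right]
  rw [integral_sub (integrable_inner_of_memLp_two hφ2 (hT.memLp_apply hu.memLp_weakJet))
      (integrable_inner_of_memLp_two hφ2 (hT.memLp_apply hv2)),
    ← correctorForm_eq_setIntegral_inner,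
    ← hφ.setIntegral_inner_classicalJet_eq (Set.subset_univ Ω),
    ← correctorForm_eq_setIntegral_inner, huℓ φ hφ, hvℓ φ (hφ.mono (Set.subset_univ Ω)), sub_self]

theorem mainTheorem7_general [NeZero d] (hD : IsOpen D) (h0 : 0 ∈ D) (hB : MeasurableSet B)
    (hA : A.PosDef) (hA₁ : A₁.PosDef) (hℓ : ∀ φ, IsTest (Metric.closedBall 0 r)ᶜ φ → ℓ φ = 0)
    {wε : ℝ → Eu d → ℂ} {w1 : Eu d → ℂ}
    (hwε : ∀ᶠ ε in 𝓝[>] (0 : ℝ), MemH10 (ε⁻¹ • D) (wε ε) ∧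
      ∀ φ, IsTest (ε⁻¹ • D) φ → correctorForm A A₁ B (ε⁻¹ • D) (wε ε) φ = ℓ φ)
    (hw1 : MemH1 Set.univ w1 ∧
      ∀ φ, IsTest Set.univ φ → correctorForm A A₁ B Set.univ w1 φ = ℓ φ) :
    (∀ᶠ ε in 𝓝[>] (0 : ℝ), MemH1 D (fun x => wε ε (ε⁻¹ • x) - w1 (ε⁻¹ • x))) ∧
    ∀ s : ℝ, (fun ε : ℝ => h1Norm D (fun x => wε ε (ε⁻¹ • x) - w1 (ε⁻¹ • x)))
      =o[𝓝[>] 0] fun ε : ℝ => ε ^ s := by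
  obtain ⟨c, K, hT⟩ := exists_isUniformlyElliptic_correctorOperator hA hA₁ hB
  constructor
  · filter_upwards [hwε, self_mem_nhdsWithin] with ε hw hε
    exact (hw.1.1.sub (hw1.1.mono (Set.subset_univ _))).comp_smul (inv_pos.2 hε)
  · exact hT.isLittleO_h1Norm_comp_smul_sub hD h0 (hwε.mono fun ε hw => hw.1) hw1.1
      (hwε.mono fun ε hw => annihilatesTests_sub_of_correctorForm_eq hT hw.1.1 hw1.1 hw.2 hw1.2)
      (annihilatesTests_of_correctorForm_eq hℓ hw1.2)

end Correctors

end

theorem mainTheorem7 {d : ℕ} (hd : d = 2 ∨ d = 3)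
    (D : Set (Eu d)) (hD : IsOpen D) (hDb : Bornology.IsBounded D) (h0 : (0 : Eu d) ∈ D)
    (B : Set (Eu d)) (hB : IsOpen B) (hBb : Bornology.IsBounded B) (hBs : HasSmoothBoundary B)
    (A A₁ : Matrix (Fin d) (Fin d) ℝ) (hA : A.PosDef) (hA₁ : A₁.PosDef)
    (w : Eu d → ℂ) (hw : ContDiffOn ℝ ∞ w D)
    (wε : ℝ → Eu d → ℂ) (w1 : Eu d → ℂ)
    (hwε : ∀ᶠ ε in 𝓝[>] (0 : ℝ),
      IsDirichletCorrector A A₁ B (ε⁻¹ • D) (fun j => partialD j w 0) (wε ε))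
    (hw1 : IsWholeSpaceCorrector A A₁ B (fun j => partialD j w 0) w1) :
    (∀ᶠ ε in 𝓝[>] (0 : ℝ), MemH1 D (fun x => wε ε (ε⁻¹ • x) - w1 (ε⁻¹ • x))) ∧
    (d = 2 →
      (fun ε : ℝ => h1Norm D (fun x => wε ε (ε⁻¹ • x) - w1 (ε⁻¹ • x)))
        =o[𝓝[>] 0] fun ε : ℝ => ε ^ ((d : ℝ) / 2 + 2)) ∧
    (d = 3 →
      (fun ε : ℝ => h1Norm D (fun x => wε ε (ε⁻¹ • x) - w1 (ε⁻¹ • x)))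
        =o[𝓝[>] 0] fun ε : ℝ => ε ^ ((d : ℝ) / 2 + 5 / 2)) := by
  have : NeZero d := ⟨by rcases hd with h | h <;> omega⟩
  obtain ⟨r, hr⟩ := hBb.subset_closedBall 0
  obtain ⟨hmem, ho⟩ := mainTheorem7_general hD h0 hB.measurableSet hA hA₁
    (fun φ => boundaryTerm_eq_zero A A₁ (fun j => partialD j w 0) hr) hwε hw1
  exact ⟨hmem, fun _ => ho _, fun _ => ho _⟩
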